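/- **Setting.** Let $\mathbb F$ be a field of characteristic $0$. A *conformal algebra* is an $\mathbb F[\partial]$-module $R$ with bilinear products $u_nv$ ($n\in\mathbb N=\{0,1,2,\dots\}$), written $Y^+(u,z)v=\sum_{n\ge 0}(u_nv)z^{-n-1}$ (a finite sum for all $u,v$), such that $$Y^+(\partial u,z)=\tfrac{d}{dz}Y^+(u,z),\qquad Y^+(u,z)v=\mathrm{Res}_x\frac{e^{x\partial}Y^+(v,-x)u}{z-x},$$ $$[Y^+(u,z_1),Y^+(v,z_2)]=\mathrm{Res}_x\frac{Y^+(Y^+(u,z_1-x)v,x)}{z_2-x},$$ where binomials are expanded in nonnegative powers of the second variable. An *ideal* is a subspace $I$ with $\partial I\subset I$ and $u_nI\subset I$ for all $u\in R$, $n\in\mathbb N$; $R$ is *simple* if its only ideals are $0$ and $R$. $R$ is *generated by* a subset $S$ if $R$ is the linear span of all $u^1_{m_1}\cdots u^p_{m_p}v$ with $u^j,v\in S$ and $p,m_j\in\mathbb N$. Let $k_1\ge 1$, $k=2k_1$ and $\mathcal A=M_{k\times k}(\mathbb F)$. For $i\in\{0,1\}$ consider the space $\mathcal A\otimes\mathbb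 F[t_1,t_2]$ and write $u_{[i,i]}(m,n)$ for $u\otimes t_1^mt_2^n$ in it; put $\delta=1$ if $i=0$ and $\delta=0$ if $i=1$. Let $$\partial u_{[i,i]}(m,n)=(m+1)u_{[i,i]}(m+1,n)+(n+1)u_{[i,i]}(m,n+1),$$ $$Y^+(u_{[i,i]}(m_1,m_2),z)v_{[i,i]}(n_1,n_2)=(n_1\delta+1)\binom{-n_1-1-\delta}{m_2}\sum_{p=0}^{m_1+m_2+n_1+\delta}\binom{p}{m_1}(uv)_{[i,i]}(p,n_2)z^{p-m_1-m_2-n_1-1-\delta}$$ $$\qquad+\epsilon_i(n_2)\binom{-n_2-1-\delta}{m_1}\sum_{q=0}^{m_1+m_2+n_2+\delta}\binom{q}{m_2}(vu)_{[i,i]}(n_1,q)z^{q-m_1-m_2-n_2-1-\delta},$$ with $\epsilon_0(n_2)=n_2+1$ and $\epsilon_1(n_2)=-1$. The element $u_{[i,i]}(m,n)$ has weight $m+n+1+\delta$. Let $$\sigma\begin{pmatrix}A_{11}&A_{12}\\A_{21}&A_{22}\end{pmatrix}=\begin{pmatrix}A_{22}^t&-A_{12}^t\\-A_{21}^t&A_{11}^t\end{pmatrix}\qquad(A_{ij}\in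 M_{k_1\times k_1}(\mathbb F))$$ be the symplectic involution and put $$R^\dagger_{k\times k,1}=\mathrm{span}\{u_{[1,1]}(m,n)-\sigma(u)_{[1,1]}(n,m)\mid u\in\mathcal A,\ m,n\in\mathbb N\},$$ $$R^\dagger_{k\times k,2}=\mathrm{span}\{u_{[0,0]}(m,n)+\sigma(u)_{[0,0]}(n,m)\mid u\in\mathcal A,\ m,n\in\mathbb N\}.$$ Write $(R^\dagger_{k\times k,j})^{(2)}$ for the subspace of elements of weight $2$, and $E_{p,q}$ for the matrix units. **Theorem 3.3.** For every $k_1\ge1$ and $k=2k_1$, $R^\dagger_{k\times k,1}$ and $R^\dagger_{k\times k,2}$ are simple conformal algebras. Their subspaces of weight $2$ are $$(R^\dagger_{k\times k,1})^{(2)}=\mathrm{span}\{(E_{p,q})_{[1,1]}(\epsilon,1-\epsilon)-(E_{k_1+q,k_1+p})_{[1,1]}(1-\epsilon,\epsilon),\ (E_{p,k_1+q})_{[1,1]}(1,0)+(E_{q,k_1+p})_{[1,1]}(0,1),$$ $$(E_{k_1+p,q})_{[1,1]}(1,0)+(E_{k_1+q,p})_{[1,1]}(0,1)\mid 1\le p,q\le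 k_1,\ \epsilon=0,1\},$$ $$(R^\dagger_{k\times k,2})^{(2)}=\mathrm{span}\{(E_{p,q}+E_{k_1+q,k_1+p})_{[0,0]}(0,0),\ (E_{p,k_1+q}-E_{q,k_1+p})_{[0,0]}(0,0),\ (E_{k_1+p,q}-E_{k_1+q,p})_{[0,0]}(0,0)\mid 1\le p,q\le k_1\}.$$ If $k_1>1$, each $R^\dagger_{k\times k,j}$ $(j=1,2)$ is generated by $(R^\dagger_{k\times k,j})^{(2)}$. If $k_1=1$, then $R^\dagger_{2\times2,1}$ is generated by $$\{(E_{1,2})_{[1,1]}(2,0)+(E_{1,2})_{[1,1]}(0,2),\ (E_{2,1})_{[1,1]}(2,0)+(E_{2,1})_{[1,1]}(0,2),\ (E_{1,1})_{[1,1]}(0,1)-(E_{2,2})_{[1,1]}(1,0)\},$$ and $R^\dagger_{2\times2,2}$ is generated by $$\{(I_2)_{[0,0]}(0,0),\ (E_{1,2})_{[0,0]}(1,0)-(E_{1,2})_{[0,0]}(0,1),\ (E_{2,1})_{[0,0]}(1,0)-(E_{2,1})_{[0,0]}(0,1)\}.$$ Moreover, for every $k_1\ge 1$, the map $u\mapsto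 u_{[0,0]}(0,0)$ is a bijection from the type-C Jordan algebra $\{u\in\mathcal A\mid\sigma(u)=u\}$ with product $uv+vu$ onto $(R^\dagger_{k\times k,2})^{(2)}$, and it carries this product to the product $x\odot y=x_1y$. -/

import Mathlib

open scoped Nat

/-! ### Conformal algebras

The operation `Y⁺(u, z) v = ∑ₙ (uₙ v) z⁻ⁿ⁻¹` is recorded through its coefficients:
`Y n u v` is the `n`-th product `uₙ v`, bilinear in `u` and `v`, for `n = 0, 1, 2, …`. -/

section Conformal

variable (F : Type*) [Field F] {R : Type*} [AddCommGroup R] [Module F R]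

/-- The subspace `W` is a conformal algebra under the (restrictions of the) operator `∂`
and the products `Y n`. The fields `deriv_zero`, `deriv_succ` say
`Y⁺(∂u, z) = d/dz Y⁺(u, z)`; `skew` is the coefficient of `z⁻ⁿ⁻¹` in
`Y⁺(u, z) v = Res_x (exp (x∂) Y⁺(v, -x) u) / (z - x)`; and `comm` is the coefficient of
`z₁⁻ᵐ⁻¹ z₂⁻ⁿ⁻¹` in
`[Y⁺(u, z₁), Y⁺(v, z₂)] = Res_x Y⁺(Y⁺(u, z₁ - x) v, x) / (z₂ - x)`. -/
structure IsConformalAlgebra (D : R →ₗ[F] R) (Y : ℕ → R →ₗ[F] R →ₗ[F] R)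
    (W : Submodule F R) : Prop where
  deriv_mem : ∀ u ∈ W, D u ∈ W
  prod_mem : ∀ n, ∀ u ∈ W, ∀ v ∈ W, Y n u v ∈ W
  locality : ∀ u ∈ W, ∀ v ∈ W, ∃ N, ∀ n, N ≤ n → Y n u v = 0
  deriv_zero : ∀ u ∈ W, ∀ v ∈ W, Y 0 (D u) v = 0
  deriv_succ : ∀ n, ∀ u ∈ W, ∀ v ∈ W, Y (n + 1) (D u) v = -((n + 1 : F) • Y n u v)
  skew : ∀ n N, ∀ u ∈ W, ∀ v ∈ W, (∀ m, N ≤ m → Y m v u = 0) →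
    Y n u v = ∑ j ∈ Finset.range N,
      ((-1 : F) ^ (n + j + 1) * ((j ! : ℕ) : F)⁻¹) • (D ^ j) (Y (n + j) v u)
  comm : ∀ m n, ∀ u ∈ W, ∀ v ∈ W, ∀ w ∈ W,
    Y m u (Y n v w) - Y n v (Y m u w) =
      ∑ i ∈ Finset.range (m + 1), (m.choose i : F) • Y (m + n - i) (Y i u v) w

/-- `I` is an ideal of the conformal algebra `W`. -/
structure IsConformalIdeal (D : R →ₗ[F] R) (Y : ℕ → R →ₗ[F] R →ₗ[F] R)
    (W I : Submodule F R) : Prop where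
  le : I ≤ W
  deriv_mem : ∀ x ∈ I, D x ∈ I
  prod_mem : ∀ n, ∀ u ∈ W, ∀ x ∈ I, Y n u x ∈ I

/-- `W` is a simple conformal algebra: a conformal algebra whose only ideals are `0` and `W`. -/
def IsSimpleConformalAlgebra (D : R →ₗ[F] R) (Y : ℕ → R →ₗ[F] R →ₗ[F] R)
    (W : Submodule F R) : Prop :=
  IsConformalAlgebra F D Y W ∧
    ∀ I : Submodule F R, IsConformalIdeal F D Y W I → I = ⊥ ∨ I = W

/-- The words `u¹_{m₁} ⋯ uᵖ_{mₚ} v` with `u¹, …, uᵖ, v ∈ S` and `p, m₁, …, mₚ ∈ ℕ`. -/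
inductive IsConformalWord (Y : ℕ → R →ₗ[F] R →ₗ[F] R) (S : Set R) : R → Prop
  | base (v : R) (hv : v ∈ S) : IsConformalWord Y S v
  | step (m : ℕ) (u w : R) (hu : u ∈ S) (hw : IsConformalWord Y S w) :
      IsConformalWord Y S (Y m u w)

/-- `W` is generated by `S`: it is the linear span of the words in `S`. -/
def IsConformallyGeneratedBy (Y : ℕ → R →ₗ[F] R →ₗ[F] R) (W : Submodule F R)
    (S : Set R) : Prop :=
  W = Submodule.span F {x | IsConformalWord F Y S x}

end Conformal

/-! ### Double affinization of an associative algebra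

For a purely even associative algebra `A`, the conformal algebra attached to `A` is
the direct sum of two ideals, spanned by the elements `u_{[0,0]}(m, n)` and by the elements
`u_{[1,1]}(m, n)` respectively. Both have underlying space `A ⊗ F[t₁, t₂]`, realized as
`ℕ × ℕ →₀ A`; the products depend on the label `i` of the summand `[i, i]`. -/

section DoubleAffinization

variable (F : Type*) [Field F] (A : Type*) [Ring A] [Algebra F A]

/-- The space `A ⊗ F[t₁, t₂]`. -/
abbrev DoubleAff (A : Type*) [Ring A] : Type _ := ℕ × ℕ →₀ A

/-- The element `u(m, n) = u ⊗ t₁ᵐ t₂ⁿ`. -/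
noncomputable def DoubleAff.elt {A : Type*} [Ring A] (u : A) (m n : ℕ) : DoubleAff A :=
  Finsupp.single (m, n) u

/-- `δ_{i,0}` -/
def DoubleAff.shift (i : Fin 2) : ℕ := if i = 0 then 1 else 0

/-- The operator `∂ u(m, n) = (m + 1) u(m + 1, n) + (n + 1) u(m, n + 1)`. -/
noncomputable def DoubleAff.deriv : DoubleAff A →ₗ[F] DoubleAff A :=
  Finsupp.lsum F fun a =>
    (a.1 + 1 : F) • Finsupp.lsingle (a.1 + 1, a.2) +
      (a.2 + 1 : F) • Finsupp.lsingle (a.1, a.2 + 1)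

/-- The coefficient of `(uv)(p, n₂)` in the `n`-th product of `u_{[i,i]}(m₁, m₂)` and
`v_{[i,i]}(n₁, n₂)`, where `p = m₁ + m₂ + n₁ + δ_{i,0} - n` (no term if this is negative). -/
noncomputable def DoubleAff.coeffLeft (i : Fin 2) (n m₁ m₂ n₁ : ℕ) : ℤ :=
  if n ≤ m₁ + m₂ + n₁ + shift i then
    ((n₁ * shift i + 1 : ℕ) : ℤ) * Ring.choose (-(n₁ : ℤ) - 1 - (shift i : ℤ)) m₂ *
      ((m₁ + m₂ + n₁ + shift i - n).choose m₁ : ℤ)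
  else 0

/-- The coefficient of `(vu)(n₁, q)` in the `n`-th product of `u_{[i,i]}(m₁, m₂)` and
`v_{[i,i]}(n₁, n₂)`, where `q = m₁ + m₂ + n₂ + δ_{i,0} - n` (no term if this is negative). -/
noncomputable def DoubleAff.coeffRight (i : Fin 2) (n m₁ m₂ n₂ : ℕ) : ℤ :=
  if n ≤ m₁ + m₂ + n₂ + shift i then
    -((if i = 1 then 1 else 0) - (if i = 0 then (n₂ : ℤ) + 1 else 0)) *
      Ring.choose (-(n₂ : ℤ) - 1 - (shift i : ℤ)) m₁ *
      ((m₁ + m₂ + n₂ + shift i - n).choose m₂ : ℤ)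
  else 0

/-- The `n`-th product on the summand `[i, i]`; see `DoubleAff.prod_elt` for its values. -/
noncomputable def DoubleAff.prod (i : Fin 2) (n : ℕ) :
    DoubleAff A →ₗ[F] DoubleAff A →ₗ[F] DoubleAff A :=
  Finsupp.lsum F fun a => LinearMap.flip <| Finsupp.lsum F fun b => LinearMap.flip <|
    (coeffLeft i n a.1 a.2 b.1 : F) •
      (LinearMap.mul F A).compr₂ (Finsupp.lsingle (a.1 + a.2 + b.1 + shift i - n, b.2)) +
    (coeffRight i n a.1 a.2 b.2 : F) •
      (LinearMap.mul F A).flip.compr₂ (Finsupp.lsingle (b.1, a.1 + a.2 + b.2 + shift i - n))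

theorem DoubleAff.deriv_elt (u : A) (m n : ℕ) :
    deriv F A (elt u m n) = (m + 1 : F) • elt u (m + 1) n + (n + 1 : F) • elt u m (n + 1) := by
  simp [deriv, elt]

theorem DoubleAff.prod_elt (i : Fin 2) (n : ℕ) (u v : A) (m₁ m₂ n₁ n₂ : ℕ) :
    prod F A i n (elt u m₁ m₂) (elt v n₁ n₂) =
      (coeffLeft i n m₁ m₂ n₁ : F) • elt (u * v) (m₁ + m₂ + n₁ + shift i - n) n₂ +
      (coeffRight i n m₁ m₂ n₂ : F) • elt (v * u) n₁ (m₁ + m₂ + n₂ + shift i - n) := by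
  simp [prod, elt]

/-- The subspace of weight `w` of the summand `[i, i]`: the element `u_{[i,i]}(m, n)` has weight
`m + n + 2 δ_{i,0} + δ_{i,1} = m + n + 1 + δ_{i,0}`. -/
noncomputable def DoubleAff.weightSpace (i : Fin 2) (w : ℕ) : Submodule F (DoubleAff A) :=
  Submodule.span F {x | ∃ (u : A) (m n : ℕ), m + n + 1 + shift i = w ∧ x = elt u m n}

end DoubleAffinization

/-! ### The symplectic involution and the two subalgebras

Matrices of size `k = 2k₁` are indexed by `Fin k₁ ⊕ Fin k₁`. -/

section Symplectic

/-- Matrices of size `2k₁`. -/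
abbrev MatEven (F : Type*) (k₁ : ℕ) : Type _ := Matrix (Fin k₁ ⊕ Fin k₁) (Fin k₁ ⊕ Fin k₁) F

variable (F : Type*) [Field F] (k₁ : ℕ)

/-- The symplectic involution
`σ(A) = [[0, I], [-I, 0]] Aᵗ [[0, -I], [I, 0]]`. -/
def sympInv (A : MatEven F k₁) : MatEven F k₁ :=
  Matrix.fromBlocks 0 1 (-1) 0 * A.transpose * Matrix.fromBlocks 0 (-1) 1 0

theorem sympInv_fromBlocks (A B C D : Matrix (Fin k₁) (Fin k₁) F) :
    sympInv F k₁ (Matrix.fromBlocks A B C D) =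
      Matrix.fromBlocks D.transpose (-B.transpose) (-C.transpose) A.transpose := by
  simp [sympInv, Matrix.fromBlocks_transpose, Matrix.fromBlocks_multiply]

/-- The operator `∂` on `M_{2k₁}(F) ⊗ F[t₁, t₂]`. -/
noncomputable abbrev matDeriv : DoubleAff (MatEven F k₁) →ₗ[F] DoubleAff (MatEven F k₁) :=
  DoubleAff.deriv F (MatEven F k₁)

/-- The products of the summand `[1, 1]` for `M_{2k₁}(F)`. -/
noncomputable abbrev matProd₁ :
    ℕ → DoubleAff (MatEven F k₁) →ₗ[F] DoubleAff (MatEven F k₁) →ₗ[F] DoubleAff (MatEven F k₁) :=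
  DoubleAff.prod F (MatEven F k₁) 1

/-- The products of the summand `[0, 0]` for `M_{2k₁}(F)`. -/
noncomputable abbrev matProd₂ :
    ℕ → DoubleAff (MatEven F k₁) →ₗ[F] DoubleAff (MatEven F k₁) →ₗ[F] DoubleAff (MatEven F k₁) :=
  DoubleAff.prod F (MatEven F k₁) 0

/-- `R†_{k×k,1}`, the span of the `u_{[1,1]}(m, n) - σ(u)_{[1,1]}(n, m)`. -/
noncomputable def RDagger₁ : Submodule F (DoubleAff (MatEven F k₁)) :=
  Submodule.span F {x | ∃ (u : MatEven F k₁) (m n : ℕ),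
    x = DoubleAff.elt u m n - DoubleAff.elt (sympInv F k₁ u) n m}

/-- `R†_{k×k,2}`, the span of the `u_{[0,0]}(m, n) + σ(u)_{[0,0]}(n, m)`. -/
noncomputable def RDagger₂ : Submodule F (DoubleAff (MatEven F k₁)) :=
  Submodule.span F {x | ∃ (u : MatEven F k₁) (m n : ℕ),
    x = DoubleAff.elt u m n + DoubleAff.elt (sympInv F k₁ u) n m}

/-- The subspace of weight `w` of `R†_{k×k,1}`. -/
noncomputable def RDagger₁.weight (w : ℕ) : Submodule F (DoubleAff (MatEven F k₁)) :=
  RDagger₁ F k₁ ⊓ DoubleAff.weightSpace F (MatEven F k₁) 1 w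

/-- The subspace of weight `w` of `R†_{k×k,2}`. -/
noncomputable def RDagger₂.weight (w : ℕ) : Submodule F (DoubleAff (MatEven F k₁)) :=
  RDagger₂ F k₁ ⊓ DoubleAff.weightSpace F (MatEven F k₁) 0 w

/-- The element `E_{a,b}(m, n)` for a matrix unit `E_{a,b}`; the row or column index `p ≤ k₁` is
`Sum.inl p`, and `k₁ + p` is `Sum.inr p`. -/
noncomputable def unitElt {k₁ : ℕ} (a b : Fin k₁ ⊕ Fin k₁) (m n : ℕ) :
    DoubleAff (MatEven F k₁) :=
  DoubleAff.elt (Matrix.single a b (1 : F)) m n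

end Symplectic

/-! ### Falling factorial identities -/

section FallingFactorial

open Finset

/-! Rescaling `u(m, n)` by `m! n!` turns the space into polynomials `u xᵃ yᵇ` over `A` on which `∂`
is multiplication by `x + y`. Write `δ` for `shift i` and `(M)ₙ` for the falling factorial. The
`n`-th product of `u xᵃ yᵇ` and `v xᶜ yᵈ` is then `(-1)ᵇ (b+c+δ)ₙ uv x^(a+b+c+δ-n) yᵈ - (-1)^(a+δ)
(a+d+δ)ₙ vu xᶜ y^(a+b+d+δ-n)` (`prod_mon`). Skew-symmetry becomes the binomial expansion of `x = (x
+ y) - y`, and the commutator formula two identities for falling factorials. So every subspace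
closed under `∂` and the products is a conformal algebra. For any linear involution `σ`, the span of
`u xᵃ yᵇ + ε σ(u) xᵇ yᵃ` with `ε = -(-1)^δ` is such a subspace (`prod_sym`); both algebras of the
theorem are instances.

Simplicity: `(M)ₙ = 0` for `M < n`, so a product with `n` chosen large keeps only the terms of top
degree. Two such products bring from a nonzero ideal all symmetrizations of `s c x`, `s` in `A`, for
one `c ≠ 0`. Simplicity of `A` replaces `A c` by `A`. The ideal then contains an element whose first
product acts on each symmetrized monomial by twice its weight, hence is everything.

Generation: the span of the words is closed under all products (commutator formula) and under `∂`,
because `∂` is itself the zeroth product with a suitable element. Modulo `∂` of the previous degree,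
`x` and `-y` agree, so each total degree `N` carries a single space of coefficients, `symLevel`. An
invertible `u` with `σ u = -u` propagates fullness from degree `N` to `N + 1`
(`symLevel_succ_eq_top`); only the lowest degrees depend on `k₁`. For `k₁ > 1` symmetric matrices
and their commutators with all matrices span the matrix algebra. For `k₁ = 1` symmetric matrices are
scalars, these commutators vanish, and explicit products of the listed generators take over. -/

theorem Nat.add_descFactorial_eq_sum (M N m : ℕ) :
    (M + N).descFactorial m =
      ∑ i ∈ range (m + 1), m.choose i * M.descFactorial i * N.descFactorial (m - i) := by
  rw [Nat.descFactorial_eq_factorial_mul_choose, Nat.add_choose_eq,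
    Finset.Nat.sum_antidiagonal_eq_sum_range_succ_mk, mul_sum]
  refine sum_congr rfl fun i hi => ?_
  have hi : i ≤ m := by simpa [Nat.lt_succ_iff] using hi
  rw [Nat.descFactorial_eq_factorial_mul_choose, Nat.descFactorial_eq_factorial_mul_choose,
    ← Nat.choose_mul_factorial_mul_factorial hi]
  ring

/-- The Vandermonde identity multiplied by `(N)ₙ`, using `(N)ₙ (N-n)ₘ₋ᵢ = (N)ₘ₊ₙ₋ᵢ`. In the
commutator formula it accounts for the words `uvw` and `wvu`. -/
theorem Nat.descFactorial_mul_add_descFactorial (M N m n : ℕ) :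
    N.descFactorial n * (M + (N - n)).descFactorial m =
      ∑ i ∈ range (m + 1),
        m.choose i * M.descFactorial i * N.descFactorial (m + n - i) := by
  rw [Nat.add_descFactorial_eq_sum, mul_sum]
  refine sum_congr rfl fun i hi => ?_
  have hi : i ≤ m := by simpa [Nat.lt_succ_iff] using hi
  rw [← Nat.descFactorial_mul_descFactorial (k := n) (m := m + n - i) (n := N) (by omega),
    show m + n - i - n = m - i by omega]
  ring

/-- Both sides are the coefficient of `tᵐ` in `((1 + t) - t)^A (1 + t)^B`. The induction uses
Pascal's rule instead: the sum for `(A+1, B, m+1)` is the one for `(A, B+1, m+1)` minus the one for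
`(A, B, m)`. -/
theorem sum_neg_one_pow_choose_mul_choose (A B m : ℕ) :
    ∑ i ∈ range (m + 1), (-1 : ℤ) ^ i * (A.choose i * (A + B - i).choose (m - i) : ℕ) =
      B.choose m := by
  induction A generalizing B m with
  | zero =>
    rw [sum_eq_single 0] <;> simp
    intro i _ hi
    simp [Nat.choose_eq_zero_of_lt (Nat.pos_of_ne_zero hi)]
  | succ A ih =>
    cases m with
    | zero => simp
    | succ m =>
      rw [sum_range_succ']
      have h1 := ih (B + 1) (m + 1)
      rw [sum_range_succ'] at h1
      have h2 := ih B m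
      have : ∀ i, (-1 : ℤ) ^ (i + 1) *
          ((A + 1).choose (i + 1) * (A + 1 + B - (i + 1)).choose (m + 1 - (i + 1)) : ℕ) =
          (-1 : ℤ) ^ (i + 1) *
          (A.choose (i + 1) * (A + (B + 1) - (i + 1)).choose (m + 1 - (i + 1)) : ℕ)
          - (-1 : ℤ) ^ i * (A.choose i * (A + B - i).choose (m - i) : ℕ) := by
        intro i
        rw [Nat.choose_succ_succ, show A + 1 + B - (i + 1) = A + B - i by omega,
          show A + (B + 1) - (i + 1) = A + B - i by omega, Nat.add_sub_add_right]
        push_cast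
        ring
      simp_rw [this]
      rw [sum_sub_distrib, h2]
      rw [Nat.choose_succ_succ' B m] at h1
      simp only [Nat.choose_zero_right, pow_zero] at h1 ⊢
      rw [show A + 1 + B - 0 = A + (B + 1) - 0 by omega]
      push_cast at h1 ⊢
      linarith

/-- Accounts for the words `vuw` and `wuv` in the commutator formula. The case `n = 0` is the
alternating binomial sum; the factor `(A+B-m)ₙ` then merges into each term. -/
theorem descFactorial_mul_descFactorial_eq_alternating_sum (A B m n : ℕ) :
    (B.descFactorial m * (A + B - m).descFactorial n : ℤ) =
      ∑ i ∈ range (m + 1), (m.choose i : ℤ) *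
        ((-1) ^ i * A.descFactorial i * (A + B - i).descFactorial (m + n - i)) := by
  have key : (B.descFactorial m : ℤ) = ∑ i ∈ range (m + 1), (m.choose i : ℤ) *
        ((-1) ^ i * A.descFactorial i * (A + B - i).descFactorial (m - i)) := by
    rw [Nat.descFactorial_eq_factorial_mul_choose, Nat.cast_mul,
      ← sum_neg_one_pow_choose_mul_choose A B m, mul_sum]
    refine sum_congr rfl fun i hi => ?_
    have hi : i ≤ m := by simpa [Nat.lt_succ_iff] using hi
    rw [Nat.descFactorial_eq_factorial_mul_choose, Nat.descFactorial_eq_factorial_mul_choose,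
      ← Nat.choose_mul_factorial_mul_factorial hi]
    push_cast
    ring
  rw [key, sum_mul]
  refine sum_congr rfl fun i hi => ?_
  have hi : i ≤ m := by simpa [Nat.lt_succ_iff] using hi
  rw [← Nat.descFactorial_mul_descFactorial (k := m - i) (m := m + n - i) (n := A + B - i)
    (by omega), show m + n - i - (m - i) = n by omega, show A + B - i - (m - i) = A + B - m by omega]
  push_cast
  ring

end FallingFactorial

/-! ### Powers and products in the divided power basis -/

namespace DoubleAff

section Mon

variable (F : Type*) [Field F] {A : Type*} [Ring A] [Algebra F A]

/-- The element `m! n! u(m, n)`. With `u xᵐ yⁿ` for `mon F u m n`, the operator `∂` is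
multiplication by `x + y`. -/
noncomputable def mon (u : A) (m n : ℕ) : DoubleAff A := ((m ! * n ! : ℕ) : F) • elt u m n

theorem mon_add (u v : A) (m n : ℕ) : mon F (u + v) m n = mon F u m n + mon F v m n := by
  simp [mon, elt]

theorem mon_smul (c : F) (u : A) (m n : ℕ) : mon F (c • u) m n = c • mon F u m n := by
  simp only [mon, elt, ← Finsupp.smul_single, smul_comm c]

/-- `mon` as a linear map. -/
noncomputable def monₗ (m n : ℕ) : A →ₗ[F] DoubleAff A where
  toFun u := mon F u m n
  map_add' u v := mon_add F u v m n
  map_smul' c u := mon_smul F c u m n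

theorem mon_neg (u : A) (m n : ℕ) : mon F (-u) m n = -mon F u m n :=
  map_neg (monₗ F m n) u

@[simp] theorem mon_zero (m n : ℕ) : mon F (0 : A) m n = 0 := map_zero (monₗ F m n)

theorem deriv_mon (u : A) (m n : ℕ) :
    deriv F A (mon F u m n) = mon F u (m + 1) n + mon F u m (n + 1) := by
  simp only [mon, map_smul, deriv_elt, smul_add, smul_smul, Nat.factorial_succ]
  push_cast
  congr 2 <;> ring

section CharZero

variable [CharZero F]

theorem elt_eq_mon (u : A) (m n : ℕ) :
    elt u m n = ((m ! * n ! : ℕ) : F)⁻¹ • mon F u m n := by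
  rw [mon, smul_smul, inv_mul_cancel₀, one_smul]
  exact_mod_cast mul_ne_zero (Nat.factorial_ne_zero m) (Nat.factorial_ne_zero n)

theorem elt_eq_mon_smul (u : A) (m n : ℕ) :
    elt u m n = mon F (((m ! * n ! : ℕ) : F)⁻¹ • u) m n := by
  rw [mon_smul, ← elt_eq_mon]

theorem induction_mon {p : DoubleAff A → Prop} (w : DoubleAff A) (zero : p 0)
    (add : ∀ v w, p v → p w → p (v + w)) (mon : ∀ u m n, p (mon F u m n)) : p w := by
  refine Finsupp.induction_linear w zero add fun a u => ?_
  have := mon (((a.1 ! * a.2 ! : ℕ) : F)⁻¹ • u) a.1 a.2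
  rwa [← elt_eq_mon_smul] at this

end CharZero

theorem choose_neg_mul_factorial (i : Fin 2) (c b : ℕ) :
    ((c * shift i + 1 : ℕ) : ℤ) * Ring.choose (-(c : ℤ) - 1 - (shift i : ℤ)) b * (b ! * c !) =
      (-1) ^ b * (b + c + shift i)! := by
  have h : Ring.choose (-(c : ℤ) - 1 - (shift i : ℤ)) b =
      (-1) ^ b * ((b + c + shift i).choose b : ℤ) := by
    rw [show -(c : ℤ) - 1 - (shift i : ℤ) = -((c + shift i + 1 : ℕ) : ℤ) by push_cast; ring,
      Ring.choose_neg, show ((c + shift i + 1 : ℕ) : ℤ) + b - 1 = ((b + c + shift i : ℕ) : ℤ) by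
        push_cast; ring, Ring.choose_natCast, Int.negOnePow_def]
    simp [Units.smul_def]
  have h2 : ((c * shift i + 1 : ℕ) : ℤ) * c ! = (c + shift i)! := by
    fin_cases i
    · simp [shift, Nat.factorial_succ]
    · simp [shift]
  have h3 := Nat.choose_mul_factorial_mul_factorial (show b ≤ b + c + shift i by omega)
  rw [show b + c + shift i - b = c + shift i by omega] at h3
  rw [h, ← h3]
  push_cast
  rw [← h2]
  push_cast
  ring

/-- No case distinction is left on the right: when `n > b + c + δ` the falling factorial vanishes,
and so does the left side, its binomial having upper entry below `a` or the term being absent. -/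
theorem coeffLeft_mul_factorial (i : Fin 2) (n a b c : ℕ) :
    coeffLeft i n a b c * (a ! * b ! * c !) =
      (-1) ^ b * (b + c + shift i).descFactorial n * (a + b + c + shift i - n)! := by
  rw [coeffLeft]
  split_ifs with h
  · have h1 := choose_neg_mul_factorial i c b
    by_cases h2 : n ≤ b + c + shift i
    · have h3 := Nat.choose_mul_factorial_mul_factorial
        (show a ≤ a + b + c + shift i - n by omega)
      rw [show a + b + c + shift i - n - a = b + c + shift i - n by omega] at h3
      rw [← h3]
      have h4 := Nat.factorial_mul_descFactorial h2
      rw [← h4] at h1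
      push_cast at h1 ⊢
      linear_combination (a + b + c + shift i - n).choose a * a ! * h1
    · rw [Nat.choose_eq_zero_of_lt (by omega), Nat.descFactorial_eq_zero_iff_lt.2 (by omega)]
      simp
  · rw [Nat.descFactorial_eq_zero_iff_lt.2 (by omega)]
    simp

theorem coeffRight_eq (i : Fin 2) (n a b d : ℕ) :
    coeffRight i n a b d = -(-1) ^ (shift i) * coeffLeft i n b a d := by
  rw [coeffRight, coeffLeft, show b + a = a + b by omega]
  split_ifs <;> fin_cases i <;> simp_all [shift]

/-- The closed form on which everything rests. The subtractions in the exponents truncate only where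
the falling factorial in front is zero. -/
theorem prod_mon (i : Fin 2) (n : ℕ) (u v : A) (a b c d : ℕ) :
    prod F A i n (mon F u a b) (mon F v c d) =
      ((-1 : F) ^ b * ((b + c + shift i).descFactorial n : F)) •
        mon F (u * v) (a + b + c + shift i - n) d -
      ((-1 : F) ^ (a + shift i) * ((a + d + shift i).descFactorial n : F)) •
        mon F (v * u) c (a + b + d + shift i - n) := by
  have hl : (coeffLeft i n a b c : F) * (a ! * b ! * c !) = (-1) ^ b *
      (b + c + shift i).descFactorial n * (a + b + c + shift i - n)! := by
    exact_mod_cast congrArg (Int.cast (R := F)) (coeffLeft_mul_factorial i n a b c)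
  have hr : (coeffLeft i n b a d : F) * (b ! * a ! * d !) = (-1) ^ a *
      (a + d + shift i).descFactorial n * (b + a + d + shift i - n)! := by
    exact_mod_cast congrArg (Int.cast (R := F)) (coeffLeft_mul_factorial i n b a d)
  rw [mon, mon, map_smul, map_smul, LinearMap.smul_apply, prod_elt, sub_eq_add_neg, ← neg_smul]
  simp only [mon, smul_add, smul_smul, coeffRight_eq]
  push_cast
  congr 2
  · linear_combination (d ! : F) * hl
  · rw [pow_add, add_comm a b]
    linear_combination -(-1) ^ shift i * (c ! : F) * hr

end Mon

end DoubleAff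

/-! ### The axioms of a conformal algebra -/

namespace DoubleAff

variable (F : Type*) [Field F] {A : Type*} [Ring A] [Algebra F A]

/-- Lets exponents with truncated subtraction be rewritten: they need to agree only when the scalar
is nonzero. -/
theorem smul_mon_congr {c c' : F} (u : A) {m m' n n' : ℕ} (hc : c = c')
    (h : c ≠ 0 → m = m' ∧ n = n') : c • mon F u m n = c' • mon F u m' n' := by
  subst hc
  by_cases hc : c = 0
  · simp [hc]
  · obtain ⟨rfl, rfl⟩ := h hc
    rfl

theorem prod_deriv_zero (i : Fin 2) [CharZero F] (u v : DoubleAff A) :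
    prod F A i 0 (deriv F A u) v = 0 := by
  induction u using induction_mon (A := A) F with
  | zero => simp
  | add u u' hu hu' => simp [hu, hu']
  | mon u a b =>
    induction v using induction_mon (A := A) F with
    | zero => simp
    | add v v' hv hv' => rw [map_add, hv, hv', add_zero]
    | mon v c d =>
      rw [deriv_mon, map_add, LinearMap.add_apply, prod_mon, prod_mon]
      rw [show a + 1 + b + c + shift i - 0 = a + (b + 1) + c + shift i - 0 by omega,
        show a + 1 + b + d + shift i - 0 = a + (b + 1) + d + shift i - 0 by omega]
      simp only [Nat.descFactorial_zero]
      module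

theorem cast_descFactorial_succ_sub (n M : ℕ) :
    (M.descFactorial (n + 1) - (M + 1).descFactorial (n + 1) : F) =
      -((n + 1) * M.descFactorial n) := by
  rw [Nat.succ_descFactorial_succ, Nat.descFactorial_succ]
  by_cases h : n ≤ M
  · push_cast [h]
    ring
  · rw [Nat.descFactorial_eq_zero_iff_lt.2 (by omega)]
    simp

theorem prod_deriv_succ (i : Fin 2) (n : ℕ) [CharZero F] (u v : DoubleAff A) :
    prod F A i (n + 1) (deriv F A u) v = -((n + 1 : F) • prod F A i n u v) := by
  induction u using induction_mon (A := A) F with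
  | zero => simp
  | add u u' hu hu' =>
    rw [map_add, map_add, map_add, LinearMap.add_apply, LinearMap.add_apply, hu, hu']
    module
  | mon u a b =>
    induction v using induction_mon (A := A) F with
    | zero => simp
    | add v v' hv hv' =>
      rw [map_add, map_add, hv, hv']
      module
    | mon v c d =>
      rw [deriv_mon, map_add, LinearMap.add_apply, prod_mon, prod_mon, prod_mon]
      rw [show a + 1 + b + c + shift i - (n + 1) = a + b + c + shift i - n by omega,
        show a + 1 + b + d + shift i - (n + 1) = a + b + d + shift i - n by omega,
        show a + (b + 1) + c + shift i - (n + 1) = a + b + c + shift i - n by omega,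
        show a + (b + 1) + d + shift i - (n + 1) = a + b + d + shift i - n by omega,
        show b + 1 + c + shift i = b + c + shift i + 1 by omega,
        show a + 1 + d + shift i = a + d + shift i + 1 by omega,
        show a + 1 + shift i = a + shift i + 1 by omega]
      have h1 := cast_descFactorial_succ_sub F n (b + c + shift i)
      have h2 := cast_descFactorial_succ_sub F n (a + d + shift i)
      match_scalars
      · linear_combination (-1) ^ b * h1
      · linear_combination -(-1) ^ (a + shift i) * h2

theorem prod_eventually_zero (i : Fin 2) [CharZero F] (u v : DoubleAff A) :
    ∃ N, ∀ n, N ≤ n → prod F A i n u v = 0 := by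
  induction u using induction_mon (A := A) F with
  | zero => exact ⟨0, by simp⟩
  | add u u' hu hu' =>
    obtain ⟨N, hN⟩ := hu
    obtain ⟨N', hN'⟩ := hu'
    refine ⟨max N N', fun n hn => ?_⟩
    rw [map_add, LinearMap.add_apply, hN n (le_of_max_le_left hn),
      hN' n (le_of_max_le_right hn), add_zero]
  | mon u a b =>
    induction v using induction_mon (A := A) F with
    | zero => exact ⟨0, by simp⟩
    | add v v' hv hv' =>
      obtain ⟨N, hN⟩ := hv
      obtain ⟨N', hN'⟩ := hv'
      refine ⟨max N N', fun n hn => ?_⟩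
      rw [map_add, hN n (le_of_max_le_left hn), hN' n (le_of_max_le_right hn), add_zero]
    | mon v c d =>
      refine ⟨a + b + c + d + shift i + 1, fun n hn => ?_⟩
      rw [prod_mon, Nat.descFactorial_eq_zero_iff_lt.2 (by omega),
        Nat.descFactorial_eq_zero_iff_lt.2 (by omega)]
      simp

/-! #### Skew-symmetry -/

/-- Expand `P = (P + Q) - Q` to the power `M - n` and absorb the binomials through `(M)ₙ (M-n choose
j) = (M)ₙ₊ⱼ / j!`. Terms with `n + j > M` vanish, so any sufficiently long range gives the same sum.
-/
theorem sum_binomial_commute {V : Type*} [AddCommGroup V] [Module F V] [CharZero F]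
    {P Q : V →ₗ[F] V} (h : Commute P Q) (z : V) (M n N : ℕ) (hN : M < n + N) :
    (M.descFactorial n : F) • (P ^ (M - n)) z =
      ∑ j ∈ Finset.range N, ((-1 : F) ^ (M + n + j) * ((j ! : ℕ) : F)⁻¹ *
        (M.descFactorial (n + j) : F)) • ((P + Q) ^ j) ((Q ^ (M - (n + j))) z) := by
  by_cases hn : M < n
  · rw [Nat.descFactorial_eq_zero_iff_lt.2 hn, Finset.sum_eq_zero]
    · simp
    · intro j _
      rw [Nat.descFactorial_eq_zero_iff_lt.2 (by omega)]
      simp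
  · push Not at hn
    obtain ⟨K, rfl⟩ := Nat.exists_eq_add_of_le hn
    have hPQ : P ^ K = ∑ j ∈ Finset.range (K + 1),
        ((-1 : F) ^ (K - j) * (K.choose j : F)) • ((P + Q) ^ j * Q ^ (K - j)) := by
      have hc : Commute (P + Q) (-Q) := (h.add_left (Commute.refl Q)).neg_right
      have := hc.add_pow K
      rw [add_neg_cancel_right] at this
      rw [this]
      refine Finset.sum_congr rfl fun j _ => ?_
      rw [neg_pow Q, mul_smul]
      rw [Nat.cast_smul_eq_nsmul, nsmul_eq_mul, Nat.cast_comm]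
      rcases Nat.even_or_odd (K - j) with he | he <;> simp [he.neg_one_pow]
    rw [show n + K - n = K by omega, hPQ, LinearMap.sum_apply, Finset.smul_sum]
    rw [← Finset.sum_subset (Finset.range_subset_range.2 (show K + 1 ≤ N by omega))]
    · refine Finset.sum_congr rfl fun j hj => ?_
      have hj : j ≤ K := by simpa [Nat.lt_succ_iff] using hj
      rw [show n + K - (n + j) = K - j by omega, LinearMap.smul_apply, smul_smul,
        Module.End.mul_apply]
      congr 1
      have h1 := Nat.descFactorial_mul_descFactorial (n := n + K) (show n ≤ n + j by omega)
      rw [show n + K - n = K by omega, show n + j - n = j by omega,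
        Nat.descFactorial_eq_factorial_mul_choose K] at h1
      rw [← h1, show n + K + n + j = (K - j) + 2 * (n + j) by omega, pow_add, pow_mul]
      have : ((j ! : ℕ) : F) ≠ 0 := by exact_mod_cast Nat.factorial_ne_zero j
      push_cast
      field_simp
      simp
    · intro j _ hj
      rw [Nat.descFactorial_eq_zero_iff_lt.2 (by simp at hj; omega)]
      simp

/-- Multiplication by `x` in the divided power basis. -/
noncomputable def mulX : DoubleAff A →ₗ[F] DoubleAff A :=
  Finsupp.lsum F fun a => (a.1 + 1 : F) • Finsupp.lsingle (a.1 + 1, a.2)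

/-- Multiplication by `y` in the divided power basis. -/
noncomputable def mulY : DoubleAff A →ₗ[F] DoubleAff A :=
  Finsupp.lsum F fun a => (a.2 + 1 : F) • Finsupp.lsingle (a.1, a.2 + 1)

theorem mulX_mon (u : A) (m n : ℕ) : mulX F (mon F u m n) = mon F u (m + 1) n := by
  simp only [mulX, mon, elt, map_smul, Finsupp.lsum_single, LinearMap.smul_apply,
    Finsupp.lsingle_apply, smul_smul, Nat.factorial_succ]
  push_cast
  congr 1; ring

theorem mulY_mon (u : A) (m n : ℕ) : mulY F (mon F u m n) = mon F u m (n + 1) := by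
  simp only [mulY, mon, elt, map_smul, Finsupp.lsum_single, LinearMap.smul_apply,
    Finsupp.lsingle_apply, smul_smul, Nat.factorial_succ]
  push_cast
  congr 1; ring

theorem mulX_pow_mon (u : A) (m n k : ℕ) :
    (mulX F ^ k) (mon F u m n) = mon F u (m + k) n := by
  induction k with
  | zero => simp
  | succ k ih => rw [pow_succ', Module.End.mul_apply, ih, mulX_mon, add_assoc]

theorem mulY_pow_mon (u : A) (m n k : ℕ) :
    (mulY F ^ k) (mon F u m n) = mon F u m (n + k) := by
  induction k with
  | zero => simp
  | succ k ih => rw [pow_succ', Module.End.mul_apply, ih, mulY_mon, add_assoc]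

theorem deriv_eq_add [CharZero F] : deriv F A = mulX F + mulY F := by
  ext1 a
  ext u
  simp [deriv, mulX, mulY]

theorem commute_mulX_mulY [CharZero F] :
    Commute (mulX F : DoubleAff A →ₗ[F] DoubleAff A) (mulY F) := by
  refine LinearMap.ext fun w => ?_
  induction w using induction_mon (A := A) F with
  | zero => simp
  | add v w hv hw => rw [map_add, map_add, hv, hw]
  | mon u m n => simp [mulX_mon, mulY_mon]

/-- The `uv` part is a power of `x` applied to `uv xᵃ yᵈ`, which is rewritten by powers of `∂ = x +
y` and of `y`; the `vu` part is the same with `x` and `y` exchanged. -/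
theorem prod_skew_mon [CharZero F] (i : Fin 2) (n N : ℕ) (u v : A) (a b c d : ℕ)
    (hN : a + b + c + d + shift i < N) :
    prod F A i n (mon F u a b) (mon F v c d) = ∑ j ∈ Finset.range N,
      ((-1 : F) ^ (n + j + 1) * ((j ! : ℕ) : F)⁻¹) •
        (deriv F A ^ j) (prod F A i (n + j) (mon F v c d) (mon F u a b)) := by
  have h1 := sum_binomial_commute F (commute_mulX_mulY F) (mon F (u * v) a d)
    (b + c + shift i) n N (by omega)
  have h2 := sum_binomial_commute F (commute_mulX_mulY F).symm (mon F (v * u) c b)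
    (a + d + shift i) n N (by omega)
  rw [add_comm (mulY F) (mulX F), ← deriv_eq_add] at h2
  rw [← deriv_eq_add] at h1
  simp only [mulX_pow_mon, mulY_pow_mon] at h1 h2
  rw [prod_mon, mul_smul, mul_smul]
  have e1 : ((b + c + shift i).descFactorial n : F) •
      mon F (u * v) (a + b + c + shift i - n) d = ((b + c + shift i).descFactorial n : F) •
      mon F (u * v) (a + (b + c + shift i - n)) d := by
    refine smul_mon_congr F _ rfl fun h => ⟨?_, rfl⟩
    have := mt (Nat.descFactorial_eq_zero_iff_lt (n := b + c + shift i) (k := n)).2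
      (by exact_mod_cast h)
    omega
  have e2 : ((a + d + shift i).descFactorial n : F) •
      mon F (v * u) c (a + b + d + shift i - n) = ((a + d + shift i).descFactorial n : F) •
      mon F (v * u) c (b + (a + d + shift i - n)) := by
    refine smul_mon_congr F _ rfl fun h => ⟨rfl, ?_⟩
    have := mt (Nat.descFactorial_eq_zero_iff_lt (n := a + d + shift i) (k := n)).2
      (by exact_mod_cast h)
    omega
  rw [e1, e2, h1, h2, Finset.smul_sum, Finset.smul_sum, ← Finset.sum_sub_distrib]
  refine Finset.sum_congr rfl fun j _ => ?_
  rw [prod_mon, map_sub, map_smul, map_smul]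
  have hs : ∀ p q : ℕ, (-1 : F) ^ p * (-1) ^ (p + q) = (-1) ^ q := fun p q => by
    rw [pow_add, ← mul_assoc, ← mul_pow]
    simp
  have s1 := hs b (c + shift i + (n + j))
  have s2 := hs (a + shift i) (d + (n + j))
  have r1 : (b + c + shift i).descFactorial (n + j) = 0 ∨
      c + d + b + shift i - (n + j) = d + (b + c + shift i - (n + j)) := by
    by_cases h : b + c + shift i < n + j
    · exact Or.inl (Nat.descFactorial_eq_zero_iff_lt.2 h)
    · exact Or.inr (by omega)
  have r2 : (a + d + shift i).descFactorial (n + j) = 0 ∨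
      c + d + a + shift i - (n + j) = c + (a + d + shift i - (n + j)) := by
    by_cases h : a + d + shift i < n + j
    · exact Or.inl (Nat.descFactorial_eq_zero_iff_lt.2 h)
    · exact Or.inr (by omega)
  rw [show d + a + shift i = a + d + shift i by omega,
    show c + b + shift i = b + c + shift i by omega]
  rw [show b + (c + shift i + (n + j)) = b + c + shift i + n + j by omega] at s1
  rw [show a + shift i + (d + (n + j)) = a + d + shift i + n + j by omega] at s2
  have t1 : ((-1 : F) ^ b * (-1) ^ (b + c + shift i + n + j)) =
    -((-1) ^ (n + j + 1) * (-1) ^ (c + shift i)) := by rw [s1]; ring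
  have t2 : ((-1 : F) ^ (a + shift i) * (-1) ^ (a + d + shift i + n + j)) =
    -((-1) ^ (n + j + 1) * (-1) ^ d) := by rw [s2]; ring
  have z1 : ((b + c + shift i).descFactorial (n + j) : F) •
      (deriv F A ^ j) (mon F (u * v) a (c + d + b + shift i - (n + j))) =
      ((b + c + shift i).descFactorial (n + j) : F) •
      (deriv F A ^ j) (mon F (u * v) a (d + (b + c + shift i - (n + j)))) := by
    rcases r1 with r | r <;> simp [r]
  have z2 : ((a + d + shift i).descFactorial (n + j) : F) •
      (deriv F A ^ j) (mon F (v * u) (c + d + a + shift i - (n + j)) b) =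
      ((a + d + shift i).descFactorial (n + j) : F) •
      (deriv F A ^ j) (mon F (v * u) (c + (a + d + shift i - (n + j))) b) := by
    rcases r2 with r | r <;> simp [r]
  rw [mul_smul ((-1 : F) ^ d), mul_smul ((-1 : F) ^ (c + shift i)), z1, z2]
  match_scalars
  · linear_combination ((j ! : ℕ) : F)⁻¹ * ((b + c + shift i).descFactorial (n + j) : F) * t1
  · linear_combination -((j ! : ℕ) : F)⁻¹ * ((a + d + shift i).descFactorial (n + j) : F) * t2

/-- An unspecified bound is additive in `u` and `v`, whereas vanishing of the products of a sum says
nothing about its summands. -/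
theorem prod_skew_eventually [CharZero F] (i : Fin 2) (n : ℕ) (u v : DoubleAff A) :
    ∃ N₀, ∀ N, N₀ ≤ N → prod F A i n u v = ∑ j ∈ Finset.range N,
      ((-1 : F) ^ (n + j + 1) * ((j ! : ℕ) : F)⁻¹) •
        (deriv F A ^ j) (prod F A i (n + j) v u) := by
  induction u using induction_mon (A := A) F with
  | zero => exact ⟨0, by simp⟩
  | add u u' hu hu' =>
    obtain ⟨N, hN⟩ := hu
    obtain ⟨N', hN'⟩ := hu'
    refine ⟨max N N', fun n hn => ?_⟩
    rw [map_add, LinearMap.add_apply, hN n (le_of_max_le_left hn),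
      hN' n (le_of_max_le_right hn), ← Finset.sum_add_distrib]
    simp only [map_add, smul_add]
  | mon u a b =>
    induction v using induction_mon (A := A) F with
    | zero => exact ⟨0, by simp⟩
    | add v v' hv hv' =>
      obtain ⟨N, hN⟩ := hv
      obtain ⟨N', hN'⟩ := hv'
      refine ⟨max N N', fun n hn => ?_⟩
      rw [map_add, hN n (le_of_max_le_left hn), hN' n (le_of_max_le_right hn),
        ← Finset.sum_add_distrib]
      simp only [map_add, smul_add, LinearMap.add_apply]
    | mon v c d =>
      exact ⟨_, fun N hN => prod_skew_mon F i n N u v a b c d hN⟩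

theorem prod_skew [CharZero F] (i : Fin 2) (n N : ℕ) (u v : DoubleAff A)
    (hN : ∀ m, N ≤ m → prod F A i m v u = 0) :
    prod F A i n u v = ∑ j ∈ Finset.range N,
      ((-1 : F) ^ (n + j + 1) * ((j ! : ℕ) : F)⁻¹) •
        (deriv F A ^ j) (prod F A i (n + j) v u) := by
  obtain ⟨N₀, h⟩ := prod_skew_eventually F i n u v
  rw [h (max N₀ N) (le_max_left _ _)]
  refine (Finset.sum_subset (Finset.range_subset_range.2 (le_max_right _ _)) ?_).symm
  intro j _ hj
  rw [hN (n + j) (by simp at hj; omega)]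
  simp

/-! #### The commutator formula -/

theorem smul_mon_of_le (x : F) (u : A) {n m M M' p p' q q' : ℕ}
    (h : n ≤ M → m ≤ M' → p = p' ∧ q = q') :
    (x * (M.descFactorial n * M'.descFactorial m : ℕ)) • mon F u p q =
      (x * (M.descFactorial n * M'.descFactorial m : ℕ)) • mon F u p' q' := by
  refine smul_mon_congr F u rfl fun h0 => ?_
  refine h ?_ ?_ <;> by_contra hlt <;> refine h0 ?_
  · simp [Nat.descFactorial_eq_zero_iff_lt.2 (not_le.1 hlt)]
  · simp [Nat.descFactorial_eq_zero_iff_lt.2 (not_le.1 hlt)]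

theorem prod_prod_mon (i : Fin 2) (m n : ℕ) (u v w : A) (a b c d e f : ℕ) :
    prod F A i m (mon F u a b) (prod F A i n (mon F v c d) (mon F w e f)) =
      ((-1 : F) ^ b * (-1) ^ d * ((d + e + shift i).descFactorial n *
        (b + c + shift i + (d + e + shift i - n)).descFactorial m : ℕ)) •
          mon F (u * v * w) (a + b + c + d + e + 2 * shift i - (m + n)) f
      + ((-1 : F) ^ (a + shift i) * (-1) ^ (c + shift i) * ((c + f + shift i).descFactorial n *
        (a + d + shift i + (c + f + shift i - n)).descFactorial m : ℕ)) •
          mon F (w * (v * u)) e (a + b + c + d + f + 2 * shift i - (m + n))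
      - ((-1 : F) ^ (a + shift i) * (-1) ^ d * ((d + e + shift i).descFactorial n *
          (a + f + shift i).descFactorial m : ℕ)) •
          mon F (v * w * u) (c + d + e + shift i - n) (a + b + f + shift i - m)
      - ((-1 : F) ^ b * (-1) ^ (c + shift i) * ((c + f + shift i).descFactorial n *
          (b + e + shift i).descFactorial m : ℕ)) •
          mon F (u * (w * v)) (a + b + e + shift i - m) (c + d + f + shift i - n) := by
  have h1 := smul_mon_of_le F ((-1) ^ b * (-1) ^ d) (u * v * w) (n := n) (m := m)
    (M := d + e + shift i) (M' := b + c + shift i + (d + e + shift i - n))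
    (p := a + b + (c + d + e + shift i - n) + shift i - m) (q := f) (q' := f)
    (p' := a + b + c + d + e + 2 * shift i - (m + n)) (by omega)
  have h2 := smul_mon_of_le F ((-1) ^ (a + shift i) * (-1) ^ (c + shift i)) (w * (v * u))
    (n := n) (m := m)
    (M := c + f + shift i) (M' := a + d + shift i + (c + f + shift i - n))
    (q := a + b + (c + d + f + shift i - n) + shift i - m) (p := e) (p' := e)
    (q' := a + b + c + d + f + 2 * shift i - (m + n)) (by omega)
  have g1 : ((d + e + shift i).descFactorial n *
      (b + (c + d + e + shift i - n) + shift i).descFactorial m) =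
      ((d + e + shift i).descFactorial n *
      (b + c + shift i + (d + e + shift i - n)).descFactorial m) := by
    rcases lt_or_ge (d + e + shift i) n with h | h
    · simp [Nat.descFactorial_eq_zero_iff_lt.2 h]
    · congr 2; omega
  have g2 : ((c + f + shift i).descFactorial n *
      (a + (c + d + f + shift i - n) + shift i).descFactorial m) =
      ((c + f + shift i).descFactorial n *
      (a + d + shift i + (c + f + shift i - n)).descFactorial m) := by
    rcases lt_or_ge (c + f + shift i) n with h | h
    · simp [Nat.descFactorial_eq_zero_iff_lt.2 h]
    · congr 2; omega
  rw [← h1, ← h2, ← g1, ← g2, prod_mon, map_sub, map_smul, map_smul, prod_mon, prod_mon]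
  simp only [mul_assoc]
  push_cast
  module

theorem prod_prod_mon_left (i : Fin 2) (k l : ℕ) (u v w : A) (a b c d e f : ℕ) :
    prod F A i l (prod F A i k (mon F u a b) (mon F v c d)) (mon F w e f) =
      ((-1 : F) ^ b * (-1) ^ d * ((b + c + shift i).descFactorial k *
        (d + e + shift i).descFactorial l : ℕ)) •
          mon F (u * v * w) (a + b + c + d + e + 2 * shift i - (k + l)) f
      + ((-1 : F) ^ (a + shift i) * (-1) ^ (c + shift i) * ((a + d + shift i).descFactorial k *
        (c + f + shift i).descFactorial l : ℕ)) •
          mon F (w * (v * u)) e (a + b + c + d + f + 2 * shift i - (k + l))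
      - ((-1 : F) ^ (a + shift i) * (-1) ^ (c + shift i) * (-1) ^ k *
        ((b + c + shift i).descFactorial k *
          ((b + c + shift i) + (a + f + shift i) - k).descFactorial l : ℕ)) •
          mon F (w * (u * v)) e (a + b + c + d + f + 2 * shift i - (k + l))
      - ((-1 : F) ^ b * (-1) ^ d * (-1) ^ k * ((a + d + shift i).descFactorial k *
          ((a + d + shift i) + (b + e + shift i) - k).descFactorial l : ℕ)) •
          mon F (v * u * w) (a + b + c + d + e + 2 * shift i - (k + l)) f := by
  have h1 := smul_mon_of_le F ((-1) ^ b * (-1) ^ d) (u * v * w) (n := k) (m := l)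
    (M := b + c + shift i) (M' := d + e + shift i)
    (p := a + b + c + shift i - k + d + e + shift i - l) (q := f) (q' := f)
    (p' := a + b + c + d + e + 2 * shift i - (k + l)) (by omega)
  have h2 := smul_mon_of_le F ((-1) ^ (a + shift i) * (-1) ^ (c + shift i)) (w * (v * u))
    (n := k) (m := l) (M := a + d + shift i) (M' := c + f + shift i)
    (q := c + (a + b + d + shift i - k) + f + shift i - l) (p := e) (p' := e)
    (q' := a + b + c + d + f + 2 * shift i - (k + l)) (by omega)
  have h3 := smul_mon_of_le F ((-1) ^ (a + shift i) * (-1) ^ (c + shift i) * (-1) ^ k)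
    (w * (u * v)) (n := k) (m := l)
    (M := b + c + shift i) (M' := (b + c + shift i) + (a + f + shift i) - k)
    (q := a + b + c + shift i - k + d + f + shift i - l) (p := e) (p' := e)
    (q' := a + b + c + d + f + 2 * shift i - (k + l)) (by omega)
  have h4 := smul_mon_of_le F ((-1) ^ b * (-1) ^ d * (-1) ^ k) (v * u * w) (n := k) (m := l)
    (M := a + d + shift i) (M' := (a + d + shift i) + (b + e + shift i) - k)
    (p := c + (a + b + d + shift i - k) + e + shift i - l) (q := f) (q' := f)
    (p' := a + b + c + d + e + 2 * shift i - (k + l)) (by omega)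
  have g3 : (-1) ^ b * (-1) ^ (a + b + c + shift i - k + shift i) *
      (((b + c + shift i).descFactorial k *
      (a + b + c + shift i - k + f + shift i).descFactorial l : ℕ) : F) =
      (-1) ^ (a + shift i) * (-1) ^ (c + shift i) * (-1) ^ k * ((b + c + shift i).descFactorial k *
          ((b + c + shift i) + (a + f + shift i) - k).descFactorial l : ℕ) := by
    rcases lt_or_ge (b + c + shift i) k with h | h
    · simp [Nat.descFactorial_eq_zero_iff_lt.2 h]
    · rw [show a + b + c + shift i - k + f + shift i =
        (b + c + shift i) + (a + f + shift i) - k by omega]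
      congr 1
      rw [← pow_add, ← pow_add, ← pow_add]
      refine neg_one_pow_congr ?_
      simp only [Nat.even_iff]
      omega
  have g4 : (-1) ^ (a + shift i) * (-1) ^ (a + b + d + shift i - k) *
      (((a + d + shift i).descFactorial k *
      (a + b + d + shift i - k + e + shift i).descFactorial l : ℕ) : F) =
      (-1) ^ b * (-1) ^ d * (-1) ^ k * ((a + d + shift i).descFactorial k *
          ((a + d + shift i) + (b + e + shift i) - k).descFactorial l : ℕ) := by
    rcases lt_or_ge (a + d + shift i) k with h | h
    · simp [Nat.descFactorial_eq_zero_iff_lt.2 h]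
    · rw [show a + b + d + shift i - k + e + shift i =
        (a + d + shift i) + (b + e + shift i) - k by omega]
      congr 1
      rw [← pow_add, ← pow_add, ← pow_add]
      refine neg_one_pow_congr ?_
      simp only [Nat.even_iff]
      omega
  rw [← h1, ← h2, ← h3, ← h4, ← g3, ← g4, prod_mon, map_sub, map_smul, map_smul,
    LinearMap.sub_apply, LinearMap.smul_apply, LinearMap.smul_apply, prod_mon, prod_mon]
  push_cast
  module

/-- On the left, the words `vwu` and `uwv` occur in both orders of multiplication and cancel. The
four remaining words are matched one by one with the sum on the right. -/
theorem prod_comm_mon (i : Fin 2) (m n : ℕ) (u v w : A) (a b c d e f : ℕ) :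
    prod F A i m (mon F u a b) (prod F A i n (mon F v c d) (mon F w e f)) -
      prod F A i n (mon F v c d) (prod F A i m (mon F u a b) (mon F w e f)) =
      ∑ k ∈ Finset.range (m + 1), (m.choose k : F) •
        prod F A i (m + n - k) (prod F A i k (mon F u a b) (mon F v c d)) (mon F w e f) := by
  set δ := shift i with hδ
  have key : ∀ k ∈ Finset.range (m + 1), (m.choose k : F) •
        prod F A i (m + n - k) (prod F A i k (mon F u a b) (mon F v c d)) (mon F w e f) =
      (((m.choose k * (b + c + δ).descFactorial k * (d + e + δ).descFactorial (m + n - k) : ℕ) : F)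
        * ((-1) ^ b * (-1) ^ d)) • mon F (u * v * w) (a + b + c + d + e + 2 * δ - (m + n)) f
      + (((m.choose k * (a + d + δ).descFactorial k * (c + f + δ).descFactorial (m + n - k) : ℕ) : F)
        * ((-1) ^ (a + δ) * (-1) ^ (c + δ))) •
          mon F (w * (v * u)) e (a + b + c + d + f + 2 * δ - (m + n))
      - (((m.choose k * ((-1) ^ k * (b + c + δ).descFactorial k *
        ((b + c + δ) + (a + f + δ) - k).descFactorial (m + n - k)) : ℤ) : F)
        * ((-1) ^ (a + δ) * (-1) ^ (c + δ))) •
          mon F (w * (u * v)) e (a + b + c + d + f + 2 * δ - (m + n))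
      - (((m.choose k * ((-1) ^ k * (a + d + δ).descFactorial k *
        ((a + d + δ) + (b + e + δ) - k).descFactorial (m + n - k)) : ℤ) : F)
        * ((-1) ^ b * (-1) ^ d)) •
          mon F (v * u * w) (a + b + c + d + e + 2 * δ - (m + n)) f := by
    intro k hk
    have hk : k ≤ m := by simpa [Nat.lt_succ_iff] using hk
    rw [prod_prod_mon_left, ← hδ, show k + (m + n - k) = m + n by omega]
    push_cast
    module
  rw [Finset.sum_congr rfl key, Finset.sum_sub_distrib, Finset.sum_sub_distrib,
    Finset.sum_add_distrib]
  simp only [← Finset.sum_smul, ← Finset.sum_mul, ← Nat.cast_sum, ← Int.cast_sum,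
    ← Nat.descFactorial_mul_add_descFactorial, ← descFactorial_mul_descFactorial_eq_alternating_sum]
  have h3 := smul_mon_of_le F ((-1) ^ (a + δ) * (-1) ^ (c + δ))
    (w * (u * v)) (n := m) (m := n)
    (M := a + f + δ) (M' := (b + c + δ) + (a + f + δ) - m)
    (q := c + d + a + b + f + 2 * δ - (n + m)) (p := e) (p' := e)
    (q' := a + b + c + d + f + 2 * δ - (m + n)) (by omega)
  have h4 := smul_mon_of_le F ((-1) ^ b * (-1) ^ d) (v * u * w) (n := m) (m := n)
    (M := b + e + δ) (M' := (a + d + δ) + (b + e + δ) - m)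
    (p := c + d + a + b + e + 2 * δ - (n + m)) (q := f) (q' := f)
    (p' := a + b + c + d + e + 2 * δ - (m + n)) (by omega)
  have g3 : (a + f + δ).descFactorial m * (c + b + δ + (a + f + δ - m)).descFactorial n =
      (a + f + δ).descFactorial m * (b + c + δ + (a + f + δ) - m).descFactorial n := by
    rcases lt_or_ge (a + f + δ) m with h | h
    · simp [Nat.descFactorial_eq_zero_iff_lt.2 h]
    · congr 2; omega
  have g4 : (b + e + δ).descFactorial m * (d + a + δ + (b + e + δ - m)).descFactorial n =
      (b + e + δ).descFactorial m * (a + d + δ + (b + e + δ) - m).descFactorial n := by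
    rcases lt_or_ge (b + e + δ) m with h | h
    · simp [Nat.descFactorial_eq_zero_iff_lt.2 h]
    · congr 2; omega
  rw [prod_prod_mon, prod_prod_mon, ← hδ, g3, g4, mul_comm ((-1 : F) ^ d) ((-1) ^ b),
    mul_comm ((-1 : F) ^ (c + δ)) ((-1) ^ (a + δ)), h3, h4]
  simp only [mul_assoc]
  push_cast
  module

theorem prod_comm [CharZero F] (i : Fin 2) (m n : ℕ) (u v w : DoubleAff A) :
    prod F A i m u (prod F A i n v w) - prod F A i n v (prod F A i m u w) =
      ∑ k ∈ Finset.range (m + 1), (m.choose k : F) •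
        prod F A i (m + n - k) (prod F A i k u v) w := by
  induction u using induction_mon (A := A) F with
  | zero => simp
  | add u u' hu hu' =>
    simp only [map_add, LinearMap.add_apply, smul_add, Finset.sum_add_distrib, ← hu, ← hu']
    abel
  | mon u a b =>
    induction v using induction_mon (A := A) F with
    | zero => simp
    | add v v' hv hv' =>
      simp only [map_add, LinearMap.add_apply, smul_add, Finset.sum_add_distrib, ← hv, ← hv']
      abel
    | mon v c d =>
      induction w using induction_mon (A := A) F with
      | zero => simp
      | add w w' hw hw' =>
        simp only [map_add, smul_add, Finset.sum_add_distrib, ← hw, ← hw']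
        abel
      | mon w e f => exact prod_comm_mon F i m n u v w a b c d e f

/-- A subspace closed under `∂` and the products is a conformal algebra. -/
theorem isConformalAlgebra_of_mem [CharZero F] (i : Fin 2) (W : Submodule F (DoubleAff A))
    (hD : ∀ u ∈ W, deriv F A u ∈ W) (hY : ∀ n, ∀ u ∈ W, ∀ v ∈ W, prod F A i n u v ∈ W) :
    IsConformalAlgebra F (deriv F A) (prod F A i) W where
  deriv_mem := hD
  prod_mem := hY
  locality u _ v _ := prod_eventually_zero F i u v
  deriv_zero u _ v _ := prod_deriv_zero F i u v
  deriv_succ n u _ v _ := prod_deriv_succ F i n u v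
  skew n N u _ v _ h := prod_skew F i n N u v h
  comm m n u _ v _ w _ := prod_comm F i m n u v w

end DoubleAff

/-! ### The symmetrized subalgebra of an algebra with involution -/

/-- An `F`-linear anti-automorphism of order two. -/
structure IsLinearInvolution {F A : Type*} [Field F] [Ring A] [Algebra F A]
    (σ : A →ₗ[F] A) : Prop where
  map_mul : ∀ u v, σ (u * v) = σ v * σ u
  map_map : ∀ u, σ (σ u) = u

theorem IsLinearInvolution.map_one {F A : Type*} [Field F] [Ring A] [Algebra F A]
    {σ : A →ₗ[F] A} (h : IsLinearInvolution σ) : σ 1 = 1 := by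
  have := h.map_mul (σ 1) 1
  rwa [mul_one, h.map_map, mul_one, eq_comm] at this

namespace DoubleAff

variable (F : Type*) [Field F] {A : Type*} [Ring A] [Algebra F A]

/-- The sign `ε` such that the elements `u(m, n) + ε σ(u)(n, m)` span a subalgebra. -/
def symSign (i : Fin 2) : F := -(-1) ^ shift i

theorem symSign_mul_self (i : Fin 2) : symSign F i * symSign F i = 1 := by
  fin_cases i <;> simp [symSign, shift]

variable {F} (σ : A →ₗ[F] A)

/-- The symmetrization of `mon F u a b`. -/
noncomputable def sym (i : Fin 2) (u : A) (a b : ℕ) : DoubleAff A :=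
  mon F u a b + symSign F i • mon F (σ u) b a

/-- The span of the symmetrized elements. -/
noncomputable def symSubspace (i : Fin 2) : Submodule F (DoubleAff A) :=
  Submodule.span F {x | ∃ u a b, x = sym σ i u a b}

theorem sym_mem (i : Fin 2) (u : A) (a b : ℕ) : sym σ i u a b ∈ symSubspace σ i :=
  Submodule.subset_span ⟨u, a, b, rfl⟩

theorem sym_add (i : Fin 2) (u v : A) (a b : ℕ) :
    sym σ i (u + v) a b = sym σ i u a b + sym σ i v a b := by
  simp only [sym, map_add, mon_add]
  module

theorem sym_smul (i : Fin 2) (c : F) (u : A) (a b : ℕ) :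
    sym σ i (c • u) a b = c • sym σ i u a b := by
  simp only [sym, map_smul, mon_smul]
  module

/-- `sym` as a linear map. -/
noncomputable def symₗ (i : Fin 2) (a b : ℕ) : A →ₗ[F] DoubleAff A where
  toFun u := sym σ i u a b
  map_add' u v := sym_add σ i u v a b
  map_smul' c u := sym_smul σ i c u a b

@[simp] theorem symₗ_apply (i : Fin 2) (a b : ℕ) (u : A) : symₗ σ i a b u = sym σ i u a b := rfl

@[simp] theorem sym_zero (i : Fin 2) (a b : ℕ) : sym σ i 0 a b = 0 := map_zero (symₗ σ i a b)

theorem deriv_sym (i : Fin 2) (u : A) (a b : ℕ) :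
    deriv F A (sym σ i u a b) = sym σ i u (a + 1) b + sym σ i u a (b + 1) := by
  simp only [sym, map_add, map_smul, deriv_mon]
  module

/-- The coefficient that the `n`-th product with `sym σ i u a b` puts in front of a monomial
of degree `c` in the first variable. -/
def symCoeff (i : Fin 2) (n : ℕ) (u : A) (a b c : ℕ) : A :=
  ((-1 : F) ^ b * ((b + c + shift i).descFactorial n : F)) • u +
    (symSign F i * (-1 : F) ^ a * ((a + c + shift i).descFactorial n : F)) • σ u

variable {σ}

theorem sym_swap (hσ : IsLinearInvolution σ) (i : Fin 2) (u : A) (a b : ℕ) :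
    sym σ i u a b = symSign F i • sym σ i (σ u) b a := by
  rw [sym, sym, hσ.map_map, smul_add, smul_smul, symSign_mul_self]
  module

/-- Exchanging `x` and `y` while applying the anti-automorphism `σ` interchanges the two halves of
`prod_mon` up to the factor `-(-1)^δ`. This is `symSign`, so the eight terms pair into
symmetrizations. -/
theorem prod_sym (hσ : IsLinearInvolution σ) (i : Fin 2) (n : ℕ) (u v : A) (a b c d : ℕ) :
    prod F A i n (sym σ i u a b) (sym σ i v c d) =
      sym σ i (symCoeff σ i n u a b c * v) (a + b + c + shift i - n) d +
      symSign F i • sym σ i (symCoeff σ i n u a b d * σ v) (a + b + d + shift i - n) c := by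
  have hs := symSign_mul_self F i
  have hp : ∀ a : ℕ, (-1 : F) ^ (a + shift i) = - symSign F i * (-1) ^ a := by
    intro a
    rw [symSign, pow_add]; ring
  simp only [sym, symCoeff, map_add, map_smul, LinearMap.add_apply, LinearMap.smul_apply,
    prod_mon, hσ.map_mul, hσ.map_map, add_mul, smul_mul_assoc, mon_add,
    mon_smul, hp, add_comm b a]
  rcases mul_self_eq_one_iff.1 hs with h | h <;> rw [h] <;> module

theorem deriv_mem_symSubspace (i : Fin 2) {w : DoubleAff A} (hw : w ∈ symSubspace σ i) :
    deriv F A w ∈ symSubspace σ i := by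
  induction hw using Submodule.span_induction with
  | mem x hx =>
    obtain ⟨u, a, b, rfl⟩ := hx
    rw [deriv_sym]
    exact add_mem (sym_mem σ i _ _ _) (sym_mem σ i _ _ _)
  | zero => simp
  | add x y _ _ hx hy => rw [map_add]; exact add_mem hx hy
  | smul c x _ hx => rw [map_smul]; exact Submodule.smul_mem _ _ hx

theorem prod_mem_symSubspace (hσ : IsLinearInvolution σ) (i : Fin 2) (n : ℕ) {v w : DoubleAff A}
    (hv : v ∈ symSubspace σ i) (hw : w ∈ symSubspace σ i) :
    prod F A i n v w ∈ symSubspace σ i := by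
  induction hv, hw using Submodule.span_induction₂ with
  | mem_mem x y hx hy =>
    obtain ⟨u, a, b, rfl⟩ := hx
    obtain ⟨v, c, d, rfl⟩ := hy
    rw [prod_sym hσ]
    exact add_mem (sym_mem σ i _ _ _) (Submodule.smul_mem _ _ (sym_mem σ i _ _ _))
  | zero_left y _ => simp
  | zero_right x _ => simp
  | add_left x y z _ _ _ hx hy =>
    rw [map_add, LinearMap.add_apply]; exact add_mem hx hy
  | add_right x y z _ _ _ hx hy => rw [map_add]; exact add_mem hx hy
  | smul_left r x y _ _ h =>
    rw [map_smul, LinearMap.smul_apply]; exact Submodule.smul_mem _ _ h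
  | smul_right r x y _ _ h => rw [map_smul]; exact Submodule.smul_mem _ _ h

theorem isConformalAlgebra_symSubspace [CharZero F] (hσ : IsLinearInvolution σ) (i : Fin 2) :
    IsConformalAlgebra F (deriv F A) (prod F A i) (symSubspace σ i) :=
  isConformalAlgebra_of_mem F i _ (fun _ hu => deriv_mem_symSubspace i hu)
    fun n _ hu _ hv => prod_mem_symSubspace hσ i n hu hv

/-! #### Ideals -/

/-- Ideals are defined by products from the left; skew-symmetry and `∂`-stability make them
two-sided. -/
theorem _root_.IsConformalIdeal.prod_mem_right {D : DoubleAff A →ₗ[F] DoubleAff A}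
    {Y : ℕ → DoubleAff A →ₗ[F] DoubleAff A →ₗ[F] DoubleAff A} {W I : Submodule F (DoubleAff A)}
    (hW : IsConformalAlgebra F D Y W) (hI : IsConformalIdeal F D Y W I) (n : ℕ)
    {x u : DoubleAff A} (hx : x ∈ I) (hu : u ∈ W) : Y n x u ∈ I := by
  obtain ⟨N, hN⟩ := hW.locality u hu x (hI.le hx)
  rw [hW.skew n N x (hI.le hx) u hu hN]
  refine Submodule.sum_mem _ fun j _ => Submodule.smul_mem _ _ ?_
  have : ∀ j : ℕ, ∀ y ∈ I, (D ^ j) y ∈ I := by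
    intro j
    induction j with
    | zero => simp
    | succ j ih => intro y hy; rw [pow_succ', Module.End.mul_apply]; exact hI.deriv_mem _ (ih y hy)
  exact this j _ (hI.prod_mem _ u hu x hx)

theorem eq_sum_mon [CharZero F] (w : DoubleAff A) (d : ℕ)
    (hd : ∀ p q, w (p, q) ≠ 0 → p ≤ d ∧ q ≤ d) :
    w = ∑ p ∈ Finset.range (d + 1), ∑ q ∈ Finset.range (d + 1),
      mon F (((p ! * q ! : ℕ) : F)⁻¹ • w (p, q)) p q := by
  simp only [← elt_eq_mon_smul, elt]
  rw [← Finset.sum_product', ← Finset.sum_subset (s₁ := w.support)]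
  · exact w.sum_single.symm
  · intro x hx
    have := hd x.1 x.2 (Finsupp.mem_support_iff.1 hx)
    simp only [Finset.mem_product, Finset.mem_range]
    omega
  · intro x _ hx
    simp [Finsupp.notMem_support_iff.1 hx]

theorem apply_swap_of_mem (hσ : IsLinearInvolution σ) (i : Fin 2) {w : DoubleAff A}
    (hw : w ∈ symSubspace σ i) (p q : ℕ) : w (q, p) = symSign F i • σ (w (p, q)) := by
  induction hw using Submodule.span_induction with
  | mem x hx =>
    obtain ⟨u, a, b, rfl⟩ := hx
    have hs := symSign_mul_self F i
    have hpq : ∀ a b : ℕ, ((a, b) : ℕ × ℕ) = (q, p) ↔ (b, a) = (p, q) := by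
      intro a b; simp only [Prod.mk.injEq]; omega
    simp only [sym, mon, elt, Finsupp.add_apply, Finsupp.smul_apply, Finsupp.single_apply, hpq]
    split_ifs <;> simp [hσ.map_map, smul_smul, mul_comm (b ! : F), ← mul_assoc, hs, add_comm]
  | zero => simp
  | add x y _ _ hx hy => simp [hx, hy]
  | smul c x _ hx => simp [hx, smul_comm c]

/-- An element of the symmetrized subspace is half the sum of its symmetrized monomials. -/
theorem exists_eq_sum_sym [CharZero F] (hσ : IsLinearInvolution σ) (i : Fin 2) {w : DoubleAff A}
    (hw : w ∈ symSubspace σ i) (h0 : w ≠ 0) :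
    ∃ (d : ℕ) (c : ℕ → ℕ → A), (∃ q ≤ d, c d q ≠ 0) ∧
      (∀ p q, c q p = symSign F i • σ (c p q)) ∧
      (2 : F) • w = ∑ p ∈ Finset.range (d + 1), ∑ q ∈ Finset.range (d + 1), sym σ i (c p q) p q := by
  classical
  have hne : w.support.Nonempty := by simpa using h0
  obtain ⟨x, hx, hmax⟩ := w.support.exists_max_image (fun x => max x.1 x.2) hne
  set c : ℕ → ℕ → A := fun p q => ((p ! * q ! : ℕ) : F)⁻¹ • w (p, q) with hc
  have hsw : ∀ p q, c q p = symSign F i • σ (c p q) := by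
    intro p q
    simp only [hc, apply_swap_of_mem hσ i hw p q, map_smul, mul_comm (p !)]
    rw [smul_comm]
  have hσ0 : ∀ u, σ u = 0 → u = 0 := fun u h => by rw [← hσ.map_map u, h, map_zero]
  have hz : symSign F i ≠ 0 := left_ne_zero_of_mul_eq_one (symSign_mul_self F i)
  have hcx : c x.1 x.2 ≠ 0 := by
    simp only [hc]
    refine smul_ne_zero (inv_ne_zero ?_) (Finsupp.mem_support_iff.1 hx)
    exact_mod_cast mul_ne_zero (Nat.factorial_ne_zero _) (Nat.factorial_ne_zero _)
  -- The largest exponent may occur in either variable; the symmetry of the coefficients moves it to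
  -- the first.
  refine ⟨max x.1 x.2, c, ?_, hsw, ?_⟩
  · rcases le_total x.1 x.2 with h | h
    · rw [max_eq_right h]
      refine ⟨x.1, h, ?_⟩
      rw [hsw x.1 x.2]
      exact smul_ne_zero hz fun h => hcx (hσ0 _ h)
    · rw [max_eq_left h]
      exact ⟨x.2, h, hcx⟩
  · have h1 := eq_sum_mon (F := F) w (max x.1 x.2) fun p q hpq => by
      have := hmax (p, q) (Finsupp.mem_support_iff.2 hpq)
      exact ⟨(le_max_left p q).trans this, (le_max_right p q).trans this⟩
    simp only [sym, Finset.sum_add_distrib]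
    have h2 : ∑ p ∈ Finset.range (max x.1 x.2 + 1), ∑ q ∈ Finset.range (max x.1 x.2 + 1),
        symSign F i • mon F (σ (c p q)) q p = w := by
      rw [Finset.sum_comm]
      simp only [← mon_smul, ← hsw]
      exact h1.symm
    rw [h2, two_smul]
    congr 1

/-- The filter for top degree: `b + p + δ < n` always, because `b < a`, and `a + p + δ ≥ n` only for
`p = d`. -/
theorem symCoeff_top (hσ : IsLinearInvolution σ) (i : Fin 2) (s : A) {a b p d n : ℕ} (hp : p ≤ d)
    (hb : b < a) (hn : n = d + a + shift i) :
    symCoeff σ i n (σ s) a b p =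
      if p = d then (symSign F i * (-1) ^ a * (n ! : F)) • s else 0 := by
  subst hn
  rw [symCoeff, Nat.descFactorial_eq_zero_iff_lt.2 (by omega : b + p + shift i < _), hσ.map_map]
  split_ifs with h
  · rw [h, add_comm a d, Nat.descFactorial_self]
    simp
  · rw [Nat.descFactorial_eq_zero_iff_lt.2 (by omega)]
    simp

/-- With `a = b + 1`, the filter sends `x^d` to `x^b`. Thus the leading coefficients in `x` survive,
multiplied on the left by an arbitrary `s`, at an arbitrary exponent `b`. -/
theorem sum_sym_mem_of_isConformalIdeal [CharZero F] (hσ : IsLinearInvolution σ) (i : Fin 2)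
    {I : Submodule F (DoubleAff A)}
    (hI : IsConformalIdeal F (deriv F A) (prod F A i) (symSubspace σ i) I) {w : DoubleAff A}
    (hw : w ∈ I) (h0 : w ≠ 0) :
    ∃ (d : ℕ) (c : ℕ → A), (∃ q ≤ d, c q ≠ 0) ∧
      ∀ s b, ∑ q ∈ Finset.range (d + 1), sym σ i (s * c q) b q ∈ I := by
  obtain ⟨d, c, hq, hc, hsum⟩ := exists_eq_sum_sym hσ i (hI.le hw) h0
  refine ⟨d, c d, hq, fun s b => ?_⟩
  have hs := symSign_mul_self F i
  set n := d + (b + 1) + shift i with hn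
  set κ : F := symSign F i * (-1) ^ (b + 1) * (n ! : F) with hκ
  have hκ0 : κ ≠ 0 := by
    refine mul_ne_zero (mul_ne_zero (left_ne_zero_of_mul_eq_one hs) ?_) ?_
    · exact pow_ne_zero _ (by simp)
    · exact_mod_cast Nat.factorial_ne_zero n
  have hmem := hI.prod_mem n _ (sym_mem σ i (σ s) (b + 1) b) _ (I.smul_mem (2 : F) hw)
  have hterm : ∀ p ∈ Finset.range (d + 1), ∀ q ∈ Finset.range (d + 1),
      prod F A i n (sym σ i (σ s) (b + 1) b) (sym σ i (c p q) p q) =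
        (if p = d then κ • sym σ i (s * c d q) b q else 0) +
          if q = d then κ • sym σ i (s * c d p) b p else 0 := by
    intro p hp q hq
    have hp : p ≤ d := by simpa [Nat.lt_succ_iff] using hp
    have hq : q ≤ d := by simpa [Nat.lt_succ_iff] using hq
    rw [prod_sym hσ, symCoeff_top hσ i s hp (Nat.lt_succ_self b) hn,
      symCoeff_top hσ i s hq (Nat.lt_succ_self b) hn]
    congr 1
    · split_ifs with h
      · rw [smul_mul_assoc, sym_smul, h]
        congr 2
        omega
      · simp
    · split_ifs with h
      · have : c d p = symSign F i • σ (c p q) := by rw [← h, hc p q]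
        rw [smul_mul_assoc, sym_smul, this, mul_smul_comm, sym_smul, smul_smul, smul_smul,
          mul_comm (symSign F i)]
        congr 2
        omega
      · simp
  rw [hsum, map_sum] at hmem
  simp only [map_sum] at hmem
  rw [Finset.sum_congr rfl fun p hp => Finset.sum_congr rfl fun q hq => hterm p hp q hq] at hmem
  simp only [Finset.sum_add_distrib, Finset.sum_ite_eq', Finset.mem_range, Nat.lt_succ_self,
    if_true] at hmem
  -- The terms with `p = d` and those with `q = d` give the same sum, whence the factor `2 κ`.
  rw [Finset.sum_comm] at hmem
  simp only [Finset.sum_ite_eq', Finset.mem_range, Nat.lt_succ_self, if_true,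
    ← Finset.smul_sum, ← two_smul F, smul_smul] at hmem
  exact (I.smul_mem_iff (mul_ne_zero two_ne_zero hκ0)).1 hmem

/-- A nonzero ideal contains all the symmetrizations of `u x` with `u` in a nonzero left ideal. -/
theorem exists_sym_mem_of_isConformalIdeal [CharZero F] (hσ : IsLinearInvolution σ) (i : Fin 2)
    {I : Submodule F (DoubleAff A)}
    (hI : IsConformalIdeal F (deriv F A) (prod F A i) (symSubspace σ i) I) {w : DoubleAff A}
    (hw : w ∈ I) (h0 : w ≠ 0) :
    ∃ c : A, c ≠ 0 ∧ ∀ s, sym σ i (s * c) 1 0 ∈ I := by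
  classical
  obtain ⟨d, c, ⟨q₀, hq₀, hcq₀⟩, hmem⟩ := sum_sym_mem_of_isConformalIdeal hσ i hI hw h0
  set e := Nat.findGreatest (fun q => c q ≠ 0) d with he
  have hce : c e ≠ 0 := Nat.findGreatest_spec (P := fun q => c q ≠ 0) hq₀ hcq₀
  have hgt : ∀ q ∈ Finset.range (d + 1), e < q → c q = 0 := by
    intro q hq hlt
    have := Nat.findGreatest_is_greatest hlt (by simpa [Nat.lt_succ_iff] using hq)
    simpa using this
  have hed : e ∈ Finset.range (d + 1) := by
    simpa [Nat.lt_succ_iff] using Nat.findGreatest_le (P := fun q => c q ≠ 0) d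
  rcases Nat.eq_zero_or_pos e with h | hpos
  -- Only the term `q = 0` is present, and `b = 1` already has the required exponents.
  · refine ⟨c e, hce, fun s => ?_⟩
    have := hmem s 1
    rw [Finset.sum_eq_single_of_mem e hed] at this
    · have h' : sym σ i (s * c e) 1 e = sym σ i (s * c e) 1 0 := by congr
      rwa [h'] at this
    intro q hq hne
    rw [hgt q hq (by omega)]
    simp
  · have hs := symSign_mul_self F i
    refine ⟨σ (c e), fun h => hce (by rw [← hσ.map_map (c e), h, map_zero]), fun s => ?_⟩
    have hz := hmem 1 0
    set n := e + 2 + shift i with hn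
    -- A second filter, now in `y`: the `x`-degree `0` is below `e`, so only `q = e` contributes,
    -- with new exponent `2 + 1 + e + δ - n = 1`.
    have hprod := hI.prod_mem n _ (sym_mem σ i (σ s) 2 1) _ hz
    have hκ0 : symSign F i * (symSign F i * (-1) ^ 2 * (n ! : F)) ≠ 0 := by
      rw [neg_one_sq, mul_one, ← mul_assoc, hs, one_mul]
      exact_mod_cast Nat.factorial_ne_zero n
    rw [map_sum, Finset.sum_eq_single_of_mem e hed] at hprod
    · rw [prod_sym hσ, symCoeff_top hσ i s (Nat.zero_le e) one_lt_two hn, if_neg hpos.ne,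
        symCoeff_top hσ i s le_rfl one_lt_two hn, if_pos rfl, zero_mul, sym_zero, zero_add,
        smul_mul_assoc, sym_smul, smul_smul, one_mul,
        show 2 + 1 + e + shift i - n = 1 by omega] at hprod
      exact (I.smul_mem_iff hκ0).1 hprod
    · intro q hq hne
      rcases lt_or_gt_of_ne hne with hlt | hlt
      · rw [prod_sym hσ, symCoeff_top hσ i s (Nat.zero_le e) one_lt_two hn, if_neg hpos.ne,
          symCoeff_top hσ i s hlt.le one_lt_two hn, if_neg hne]
        simp
      · rw [hgt q hq hlt]
        simp

theorem symCoeff_shift_one (i : Fin 2) (u : A) (c : ℕ) :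
    symCoeff σ i (1 + shift i) u 1 0 c =
      ((c + shift i).descFactorial (1 + shift i) : F) • u -
        (symSign F i * ((1 + c + shift i).descFactorial (1 + shift i) : F)) • σ u := by
  rw [symCoeff, zero_add]
  module

/-- A nonzero ideal contains all the symmetrizations of `u x`. -/
theorem sym_one_zero_mem_of_isConformalIdeal [CharZero F] [IsSimpleRing A]
    (hσ : IsLinearInvolution σ) (i : Fin 2) {I : Submodule F (DoubleAff A)}
    (hI : IsConformalIdeal F (deriv F A) (prod F A i) (symSubspace σ i) I) {w : DoubleAff A}
    (hw : w ∈ I) (h0 : w ≠ 0) (t : A) : sym σ i t 1 0 ∈ I := by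
  obtain ⟨c, hc, hmem⟩ := exists_sym_mem_of_isConformalIdeal hσ i hI hw h0
  have hr : ∀ s u, sym σ i (s * c * u) 1 0 ∈ I := by
    intro s u
    -- This order preserves the degree of `x`. The first half has coefficient in the left ideal of
    -- `c`, hence lies in `I`; the second is a nonzero multiple of the symmetrization of `s c u x`.
    have h1 := hI.prod_mem (1 + shift i) _ (sym_mem σ i u 1 0) _ (hmem s)
    rw [prod_sym hσ, symCoeff_shift_one, symCoeff_shift_one,
      show 1 + 0 + 1 + shift i - (1 + shift i) = 1 by omega,
      show 1 + 0 + 0 + shift i - (1 + shift i) = 0 by omega,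
      Nat.descFactorial_eq_zero_iff_lt.2 (show 0 + shift i < 1 + shift i by omega),
      show 1 + 0 + shift i = 1 + shift i by omega, Nat.descFactorial_self] at h1
    rw [← mul_assoc] at h1
    have h2 := (I.add_mem_iff_right (hmem _)).1 h1
    rw [Nat.cast_zero, zero_smul, zero_sub, neg_mul, smul_mul_assoc, ← hσ.map_mul, ← neg_smul,
      sym_smul, smul_smul, show symSign F i * -(symSign F i * ((1 + shift i)! : F)) =
        -((1 + shift i)! * symSign F i) * symSign F i by ring, mul_smul, ← sym_swap hσ] at h2
    refine (I.smul_mem_iff ?_).1 h2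
    refine neg_ne_zero.2 (mul_ne_zero ?_ (left_ne_zero_of_mul_eq_one (symSign_mul_self F i)))
    exact_mod_cast Nat.factorial_ne_zero _
  set J : Submodule F A := I.comap (symₗ σ i 1 0) with hJ
  have hc' : TwoSidedIdeal.span {c} = ⊤ := by
    refine (eq_bot_or_eq_top _).resolve_left fun h => hc ?_
    have : c ∈ TwoSidedIdeal.span {c} := TwoSidedIdeal.subset_span rfl
    rwa [h, TwoSidedIdeal.mem_bot] at this
  have ht : t ∈ TwoSidedIdeal.span {c} := hc' ▸ trivial
  -- The two-sided ideal of `c` is the additive group generated by the products `a c b`, so `J` need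
  -- not be known to be an ideal.
  rw [TwoSidedIdeal.mem_span_iff_mem_addSubgroup_closure] at ht
  refine (AddSubgroup.closure_le J.toAddSubgroup).2 ?_ ht
  rintro _ ⟨_, ⟨a, -, y, rfl, rfl⟩, b, -, rfl⟩
  exact hr a b

theorem isSimpleConformalAlgebra_symSubspace [CharZero F] [IsSimpleRing A]
    (hσ : IsLinearInvolution σ) (i : Fin 2) :
    IsSimpleConformalAlgebra F (deriv F A) (prod F A i) (symSubspace σ i) := by
  have hW := isConformalAlgebra_symSubspace hσ i
  refine ⟨hW, fun I hI => ?_⟩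
  by_cases hI0 : I = ⊥
  · exact Or.inl hI0
  obtain ⟨w, hw, h0⟩ := Submodule.exists_mem_ne_zero_of_ne_bot hI0
  refine Or.inr (le_antisymm hI.le ?_)
  have h1 := sym_one_zero_mem_of_isConformalIdeal hσ i hI hw h0
  -- `ω` is twice a Virasoro-like element: its first product multiplies each symmetrized monomial by
  -- twice the weight `c + d + 1 + δ`, which is never zero. It comes from `x^(1-δ)` with coefficient
  -- `1`.
  have hω : ∃ ω ∈ I, ∀ v c d, ∃ r : F, r ≠ 0 ∧
      prod F A i 1 ω (sym σ i v c d) = r • sym σ i v c d := by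
    have hi : shift i = 0 ∨ shift i = 1 := by fin_cases i <;> simp [shift]
    rcases hi with hi | hi
    · refine ⟨_, h1 1, fun v c d => ⟨2 * (c + d + 1), ?_, ?_⟩⟩
      · exact mul_ne_zero two_ne_zero (by exact_mod_cast (c + d).succ_ne_zero)
      · rw [prod_sym hσ]
        simp only [symCoeff, symSign, hi, hσ.map_one, zero_add, Nat.descFactorial_one, add_zero,
          Nat.add_sub_cancel_left, add_mul, smul_mul_assoc, one_mul, sym_add, sym_smul, smul_add]
        have h := sym_swap hσ i v c d
        simp only [symSign, hi] at h
        rw [h]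
        push_cast
        module
    · refine ⟨sym σ i 1 0 0, ?_, fun v c d => ⟨2 * (c + d + 2), ?_, ?_⟩⟩
      · have h2 := hI.prod_mem 2 _ (sym_mem σ i 1 0 0) _ (h1 1)
        rw [prod_sym hσ] at h2
        simp [symCoeff, symSign, hi, hσ.map_one] at h2
        rw [show ((2 : F) • 1 + (2 : F) • 1 : A) = (4 : F) • 1 by module, sym_smul] at h2
        exact (I.smul_mem_iff (by norm_num)).1 h2
      · exact mul_ne_zero two_ne_zero (by exact_mod_cast (c + d + 1).succ_ne_zero)
      · rw [prod_sym hσ]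
        simp only [symCoeff, symSign, hi, hσ.map_one, zero_add, Nat.descFactorial_one, add_zero,
          Nat.add_sub_cancel, add_mul, smul_mul_assoc, one_mul, sym_add, sym_smul, smul_add]
        have h := sym_swap hσ i v c d
        simp only [symSign, hi] at h
        rw [h]
        push_cast
        module
  obtain ⟨ω, hω, hdiag⟩ := hω
  refine Submodule.span_le.2 ?_
  rintro _ ⟨v, c, d, rfl⟩
  obtain ⟨r, hr, h⟩ := hdiag v c d
  have := hI.prod_mem_right hW 1 hω (sym_mem σ i v c d)
  rw [h] at this
  exact (I.smul_mem_iff hr).1 this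

end DoubleAff

/-! ### Generation -/

namespace DoubleAff

variable {F : Type*} [Field F] {A : Type*} [Ring A] [Algebra F A]

/-! ### The span of the words is closed under all products. -/

section Words

variable (i : Fin 2) (S : Set (DoubleAff A))

variable (F) in
/-- The span of the words in `S`. -/
noncomputable def wordSpan : Submodule F (DoubleAff A) :=
  Submodule.span F {x | IsConformalWord F (prod F A i) S x}

variable {i S}

theorem subset_wordSpan : S ⊆ wordSpan F i S :=
  fun _ hx => Submodule.subset_span (IsConformalWord.base _ hx)

theorem prod_mem_wordSpan_of_mem {u y : DoubleAff A} (n : ℕ) (hu : u ∈ S)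
    (hy : y ∈ wordSpan F i S) : prod F A i n u y ∈ wordSpan F i S := by
  rw [wordSpan] at hy
  induction hy using Submodule.span_induction with
  | mem x hx => exact Submodule.subset_span (IsConformalWord.step n u x hu hx)
  | zero => simp
  | add x y _ _ hx hy => rw [map_add]; exact add_mem hx hy
  | smul c x _ hx => rw [map_smul]; exact Submodule.smul_mem _ _ hx

/-- The last term of the commutator formula is `(u_m w)_n y`; the others involve `u_k w` with `k <
m`. Hence an induction on `m` inside the induction on the word. -/
theorem prod_mem_wordSpan_of_isConformalWord [CharZero F] {x y : DoubleAff A} (n : ℕ)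
    (hx : IsConformalWord F (prod F A i) S x) (hy : y ∈ wordSpan F i S) :
    prod F A i n x y ∈ wordSpan F i S := by
  induction hx generalizing n y with
  | base v hv => exact prod_mem_wordSpan_of_mem n hv hy
  | step m u w hu hw ih =>
    induction m using Nat.strong_induction_on generalizing n with
    | _ m ihm =>
      have h := prod_comm F i m n u w y
      rw [Finset.sum_range_succ, Nat.choose_self, Nat.cast_one, one_smul,
        Nat.add_sub_cancel_left] at h
      rw [← sub_eq_iff_eq_add'.2 h]
      refine sub_mem (sub_mem ?_ ?_) (sum_mem fun k hk => Submodule.smul_mem _ _ ?_)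
      · exact prod_mem_wordSpan_of_mem m hu (ih n hy)
      · exact ih n (prod_mem_wordSpan_of_mem m hu hy)
      · exact ihm k (Finset.mem_range.1 hk) _

theorem prod_mem_wordSpan [CharZero F] {x y : DoubleAff A} (n : ℕ)
    (hx : x ∈ wordSpan F i S) (hy : y ∈ wordSpan F i S) :
    prod F A i n x y ∈ wordSpan F i S := by
  rw [wordSpan] at hx
  induction hx using Submodule.span_induction with
  | mem x h => exact prod_mem_wordSpan_of_isConformalWord n h hy
  | zero => simp
  | add x z _ _ hx hz =>
    rw [map_add, LinearMap.add_apply]; exact add_mem hx hz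
  | smul c x _ hx =>
    rw [map_smul, LinearMap.smul_apply]; exact Submodule.smul_mem _ _ hx

theorem wordSpan_le {W : Submodule F (DoubleAff A)} (hS : S ⊆ W)
    (hW : ∀ n, ∀ u ∈ W, ∀ v ∈ W, prod F A i n u v ∈ W) : wordSpan F i S ≤ W := by
  refine Submodule.span_le.2 fun x hx => ?_
  induction hx with
  | base v hv => exact hS hv
  | step m u w hu _ ih => exact hW m u (hS hu) w ih

end Words

/-! ### Coefficient spaces by total degree. -/

section Level

variable {σ : A →ₗ[F] A} {i : Fin 2} {G : Submodule F (DoubleAff A)}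

variable (σ i G) in
/-- The coefficients `t` such that all the symmetrizations of `t xᵃ yᵇ` with `a + b = N`
belong to `G`. -/
def symLevel (N : ℕ) : Submodule F A where
  carrier := {t | ∀ a b, a + b = N → sym σ i t a b ∈ G}
  add_mem' hs ht a b h := by rw [sym_add]; exact add_mem (hs a b h) (ht a b h)
  zero_mem' a b _ := by simp
  smul_mem' c t ht a b h := by rw [sym_smul]; exact G.smul_mem c (ht a b h)

theorem sym_mem_of_symLevel_eq_top {N a b : ℕ} (h : symLevel σ i G N = ⊤) (t : A)
    (hab : a + b = N) : sym σ i t a b ∈ G :=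
  (h ▸ Submodule.mem_top : t ∈ symLevel σ i G N) a b hab

theorem symSubspace_le_of_symLevel_eq_top (h : ∀ N, symLevel σ i G N = ⊤) :
    symSubspace σ i ≤ G := by
  refine Submodule.span_le.2 ?_
  rintro _ ⟨u, a, b, rfl⟩
  exact sym_mem_of_symLevel_eq_top (h _) u rfl

/-- Words do not involve `∂`; this recovers `∂` as a product, so that a span of words containing
such an element is `∂`-stable. -/
theorem prod_zero_sym [CharZero F] (hσ : IsLinearInvolution σ) {q : A} (hq : q + σ q = 1)
    {w : DoubleAff A} (hw : w ∈ symSubspace σ i) :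
    prod F A i 0 (sym σ i q (1 - shift i) 0) w = deriv F A w := by
  induction hw using Submodule.span_induction with
  | mem x hx =>
    obtain ⟨v, c, d, rfl⟩ := hx
    have hc : ∀ c, symCoeff σ i 0 q (1 - shift i) 0 c = 1 := by
      intro c
      rw [← hq]
      fin_cases i <;> simp [symCoeff, symSign, shift]
    have hi : shift i ≤ 1 := by fin_cases i <;> simp [shift]
    rw [prod_sym hσ, hc, hc, deriv_sym, one_mul, one_mul, ← sym_swap hσ,
      show 1 - shift i + 0 + c + shift i - 0 = c + 1 by omega,
      show 1 - shift i + 0 + d + shift i - 0 = d + 1 by omega]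
  | zero => simp
  | add x y _ _ hx hy => rw [map_add, map_add, hx, hy]
  | smul c x _ hx => rw [map_smul, map_smul, hx]

section Subalgebra

variable (hD : ∀ x ∈ G, deriv F A x ∈ G) (hY : ∀ n, ∀ x ∈ G, ∀ y ∈ G, prod F A i n x y ∈ G)
include hD

theorem sym_succ_mem_iff {a b : ℕ} (h : symLevel σ i G (a + b) = ⊤) (t : A) :
    sym σ i t (a + 1) b ∈ G ↔ sym σ i t a (b + 1) ∈ G := by
  have := hD _ (sym_mem_of_symLevel_eq_top h t rfl)
  rw [deriv_sym] at this
  exact ⟨fun h => (G.add_mem_iff_right h).1 this, fun h => (G.add_mem_iff_left h).1 this⟩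

/-- Since `x + y` maps the full degree `N` into `G`, one factor `x` can be traded for `y`; one pair
of exponents therefore decides for all. -/
theorem mem_symLevel_succ {a b N : ℕ} (h : symLevel σ i G N = ⊤) {t : A} (hab : a + b = N + 1)
    (ht : sym σ i t a b ∈ G) : t ∈ symLevel σ i G (N + 1) := by
  have key : ∀ a b, a + b = N + 1 → (sym σ i t a b ∈ G ↔ sym σ i t 0 (N + 1) ∈ G) := by
    intro a
    induction a with
    | zero => intro b hb; rw [← hb, zero_add]
    | succ a ih =>
      intro b hb
      rw [← ih (b + 1) (by omega)]
      exact sym_succ_mem_iff hD (show symLevel σ i G (a + b) = ⊤ by rwa [show a + b = N by omega]) t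
  intro a' b' hab'
  rw [key a' b' hab', ← key a b hab]
  exact ht

theorem sub_mem_symLevel_succ {a b N : ℕ} (h : symLevel σ i G N = ⊤) {s t : A} (hab : a + b = N)
    (hst : sym σ i s (a + 1) b + sym σ i t a (b + 1) ∈ G) : s - t ∈ symLevel σ i G (N + 1) := by
  refine mem_symLevel_succ hD h (show a + 1 + b = N + 1 by omega) ?_
  have := hD _ (sym_mem_of_symLevel_eq_top h t hab)
  rw [deriv_sym] at this
  rw [show sym σ i (s - t) (a + 1) b = sym σ i s (a + 1) b - sym σ i t (a + 1) b from
    map_sub (symₗ σ i (a + 1) b) s t]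
  convert G.sub_mem hst this using 1
  abel

variable (hσ : IsLinearInvolution σ)
include hσ

/-- Comes from a relation, not from a product: for `δ = 0` the symmetrization of `(v + σ v) x y` is
zero; for `δ = 1` those of `v x` and `σ v y` coincide. -/
theorem add_map_mem_symLevel (h : symLevel σ i G (1 - shift i) = ⊤) (v : A) :
    v + σ v ∈ symLevel σ i G (2 - shift i) := by
  have hi : shift i = 0 ∨ shift i = 1 := by fin_cases i <;> simp [shift]
  rw [show 2 - shift i = 1 - shift i + 1 by omega]
  rcases hi with hi | hi
  · refine mem_symLevel_succ hD h (show 1 + 1 = 1 - shift i + 1 by omega) ?_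
    have h1 := sym_swap hσ i v 1 1
    rw [sym_add, h1, symSign, hi]
    simp
  · rw [← sub_neg_eq_add]
    refine sub_mem_symLevel_succ hD h (show 0 + 0 = 1 - shift i by omega) ?_
    rw [sym_swap hσ i _ 0, map_neg, hσ.map_map, show sym σ i (-v) (0 + 1) 0 = -sym σ i v (0 + 1) 0
      from map_neg (symₗ σ i _ 0) v, symSign, hi]
    simp

include hY

/-- The zeroth product of `u x^(1-δ)` and `v x^(1-δ)` contributes `(u + σ u) v` at `x^(2-δ)` and `v
(u + σ u)` at `x^(1-δ) y`. -/
theorem commutator_mem_symLevel (h : symLevel σ i G (1 - shift i) = ⊤) (u v : A) :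
    (u + σ u) * v - v * (u + σ u) ∈ symLevel σ i G (2 - shift i) := by
  have hi : shift i ≤ 1 := by fin_cases i <;> simp [shift]
  rw [show 2 - shift i = 1 - shift i + 1 by omega]
  refine sub_mem_symLevel_succ hD h (add_zero (1 - shift i)) ?_
  have hc : ∀ c, symCoeff σ i 0 u (1 - shift i) 0 c = u + σ u := by
    intro c
    fin_cases i <;> simp [symCoeff, symSign, shift]
  have h1 := hY 0 _ (sym_mem_of_symLevel_eq_top h u (add_zero _)) _
    (sym_mem_of_symLevel_eq_top h v (add_zero _))
  rw [prod_sym hσ, hc, hc] at h1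
  convert h1 using 2
  · congr 1; omega
  · rw [sym_swap hσ, hσ.map_mul, map_add, hσ.map_map, add_comm (σ u)]
    congr 2
    omega

/-- The first product of `u x^(2-δ)` with `v xᶜ yᵈ` gives a combination of `uv` and `vu` depending
on `c` and `d`. Two choices of `(c, d)` separate them, and `u` is invertible. -/
theorem symLevel_succ_eq_top [CharZero F] {u : A} (hu : IsUnit u) (huσ : σ u = -u) {N : ℕ}
    (hN : 1 ≤ N) (h : symLevel σ i G N = ⊤) (h2 : symLevel σ i G (2 - shift i) = ⊤) :
    symLevel σ i G (N + 1) = ⊤ := by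
  have hi : shift i ≤ 1 := by fin_cases i <;> simp [shift]
  have hc : ∀ c, symCoeff σ i 1 u (2 - shift i) 0 c = (2 * c + 2 + shift i : F) • u := by
    intro c
    fin_cases i <;> simp [symCoeff, symSign, shift, huσ] <;> module
  have hE : ∀ v c d, c + d = N → (2 * c + 2 + shift i : F) • (u * v) +
      (2 * d + 2 + shift i : F) • (v * u) ∈ symLevel σ i G (N + 1) := by
    intro v c d hcd
    have h1 := hY 1 _ (sym_mem_of_symLevel_eq_top h2 u (add_zero _)) _
      (sym_mem_of_symLevel_eq_top h v hcd)
    rw [prod_sym hσ, hc, hc] at h1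
    rw [← sub_neg_eq_add]
    refine sub_mem_symLevel_succ hD h hcd ?_
    convert h1 using 2
    · rw [smul_mul_assoc]; congr 1; omega
    · rw [sym_swap hσ, map_neg, map_smul, hσ.map_mul, huσ, smul_mul_assoc, neg_mul, smul_neg,
        neg_neg]
      congr 2
      omega
  have hcomm : ∀ v, u * v - v * u ∈ symLevel σ i G (N + 1) := by
    intro v
    -- The second exponent pair exists because `N ≥ 1`; the difference is `2 (uv - vu)`.
    have := sub_mem (hE v N 0 (add_zero N)) (hE v (N - 1) 1 (by omega))
    rw [Nat.cast_sub hN] at this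
    refine (Submodule.smul_mem_iff _ (two_ne_zero (α := F))).1 ?_
    convert this using 1
    push_cast
    module
  have hmul : ∀ v, u * v ∈ symLevel σ i G (N + 1) := by
    intro v
    have := add_mem (hE v N 0 (add_zero N))
      (Submodule.smul_mem _ ((2 : F) + shift i) (hcomm v))
    have hne : (2 * N + 4 + 2 * shift i : F) ≠ 0 := by
      exact_mod_cast (show 2 * N + 4 + 2 * shift i ≠ 0 by omega)
    refine (Submodule.smul_mem_iff _ hne).1 ?_
    convert this using 1
    push_cast
    module
  obtain ⟨u, rfl⟩ := hu
  refine Submodule.eq_top_iff'.2 fun v => ?_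
  simpa using hmul (↑u⁻¹ * v)

theorem symSubspace_le_of_symLevel [CharZero F] {u : A} (hu : IsUnit u) (huσ : σ u = -u)
    (h0 : symLevel σ i G 0 = ⊤) (h1 : symLevel σ i G 1 = ⊤)
    (h2 : symLevel σ i G (2 - shift i) = ⊤) : symSubspace σ i ≤ G := by
  refine symSubspace_le_of_symLevel_eq_top fun N => ?_
  induction N with
  | zero => exact h0
  | succ N ih =>
    rcases Nat.eq_zero_or_pos N with rfl | hN
    · exact h1
    · exact symLevel_succ_eq_top hD hY hσ hu huσ hN ih h2

end Subalgebra

end Level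

end DoubleAff

/-! ### The symplectic involution -/

section Symplectic

variable (F : Type*) [Field F] (k₁ : ℕ)

/-- The symplectic involution as a linear map. -/
def sympInvₗ : MatEven F k₁ →ₗ[F] MatEven F k₁ where
  toFun := sympInv F k₁
  map_add' u v := by simp [sympInv, mul_add, add_mul]
  map_smul' c u := by simp [sympInv]

@[simp] theorem sympInvₗ_apply (u : MatEven F k₁) : sympInvₗ F k₁ u = sympInv F k₁ u := rfl

theorem isLinearInvolution_sympInvₗ : IsLinearInvolution (sympInvₗ F k₁) where
  map_mul u v := by
    have h : (Matrix.fromBlocks 0 (-1) 1 0 : MatEven F k₁) * Matrix.fromBlocks 0 1 (-1) 0 = 1 := by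
      simp [Matrix.fromBlocks_multiply]
    simp only [sympInvₗ_apply, sympInv, Matrix.transpose_mul, mul_assoc]
    rw [← mul_assoc (Matrix.fromBlocks 0 (-1) 1 0) (Matrix.fromBlocks 0 1 (-1) 0), h, one_mul]
  map_map u := by
    rw [← Matrix.fromBlocks_toBlocks u]
    simp only [sympInvₗ_apply, sympInv_fromBlocks]
    simp

variable {F k₁}

/-- The sign of an index: `1` on the first half, `-1` on the second. -/
def indexSign (F : Type*) [Field F] {k₁ : ℕ} : Fin k₁ ⊕ Fin k₁ → F :=
  Sum.elim (fun _ => 1) (fun _ => -1)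

theorem sympInv_single (a b : Fin k₁ ⊕ Fin k₁) :
    sympInv F k₁ (Matrix.single a b 1) =
      (indexSign F a * indexSign F b) • Matrix.single b.swap a.swap 1 := by
  rw [sympInv]
  ext c d
  rcases a with a | a <;> rcases b with b | b <;> rcases c with c | c <;> rcases d with d | d <;>
    simp [Matrix.mul_apply, Matrix.single_apply, Matrix.fromBlocks, indexSign, Matrix.one_apply,
      and_comm, eq_comm] <;>
    by_cases h : a = d <;> by_cases h' : b = c <;> simp [h, h', eq_comm]

theorem Submodule.eq_top_of_single_mem {n : Type*} [Fintype n] [DecidableEq n]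
    {T : Submodule F (Matrix n n F)} (h : ∀ a b, Matrix.single a b (1 : F) ∈ T) : T = ⊤ := by
  refine Submodule.eq_top_iff'.2 fun u => ?_
  rw [Matrix.matrix_eq_sum_single u]
  refine sum_mem fun a _ => sum_mem fun b _ => ?_
  have := T.smul_mem (u a b) (h a b)
  rwa [Matrix.smul_single, smul_eq_mul, mul_one] at this

variable (F) in
theorem Matrix.single_mul_single_eq_ite {n : Type*} [Fintype n] [DecidableEq n] (a b c d : n) :
    (Matrix.single a b 1 * Matrix.single c d 1 : Matrix n n F) =
      if b = c then Matrix.single a d 1 else 0 := by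
  split_ifs with h
  · rw [h, Matrix.single_mul_single_same, one_mul]
  · rw [Matrix.single_mul_single_of_ne _ _ _ _ h]

theorem Sum.swap_ne_self {α : Type*} (a : α ⊕ α) : a.swap ≠ a := by
  rcases a with a | a <;> simp

/-- The symmetric matrices and their commutators with all matrices span everything. -/
theorem Submodule.eq_top_of_sympInv_symm_mem [CharZero F] (hk : 1 < k₁)
    {T : Submodule F (MatEven F k₁)}
    (h1 : ∀ u, u + sympInv F k₁ u ∈ T)
    (h2 : ∀ u v, (u + sympInv F k₁ u) * v - v * (u + sympInv F k₁ u) ∈ T) : T = ⊤ := by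
  have hsw : ∀ a : Fin k₁ ⊕ Fin k₁, a ≠ a.swap := fun a => (Sum.swap_ne_self a).symm
  have hex : ∀ a : Fin k₁ ⊕ Fin k₁, ∃ c, c ≠ a ∧ c ≠ a.swap := by
    have : Nontrivial (Fin k₁) := Fin.nontrivial_iff_two_le.2 hk
    intro a
    rcases a with a | a <;> obtain ⟨r, hr⟩ := exists_ne a <;> exact ⟨Sum.inl r, by simp [hr]⟩
  have hE : ∀ a b c d : Fin k₁ ⊕ Fin k₁,
      (if b = c then Matrix.single a d (1 : F) else 0) +
        (indexSign F a * indexSign F b) •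
          (if a.swap = c then Matrix.single b.swap d (1 : F) else 0) -
        ((if d = a then Matrix.single c b (1 : F) else 0) +
        (indexSign F a * indexSign F b) •
          (if d = b.swap then Matrix.single c a.swap (1 : F) else 0)) ∈ T := by
    intro a b c d
    have := h2 (Matrix.single a b 1) (Matrix.single c d 1)
    rw [sympInv_single, add_mul, mul_add, smul_mul_assoc, mul_smul_comm] at this
    simpa only [Matrix.single_mul_single_eq_ite] using this
  have hss : ∀ a : Fin k₁ ⊕ Fin k₁, indexSign F a * indexSign F a = 1 := by
    rintro (a | a) <;> simp [indexSign]
  refine Submodule.eq_top_of_single_mem fun a b => ?_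
  by_cases hab : a = b
  · subst hab
    -- Diagonal units: `E_aa - E_cc`, `E_aa - E_c'c'` and `E_cc + E_c'c'` add up to `2 E_aa`, where
    -- `c'` is the swap of `c`. A `c` outside `a` and its swap exists because `k₁ > 1`.
    obtain ⟨c, hc, hc'⟩ := hex a
    have hd : ∀ c, c ≠ a → c ≠ a.swap →
        (Matrix.single a a 1 - Matrix.single c c 1 : MatEven F k₁) ∈ T := by
      intro c hc hc'
      have hc'' : a ≠ c.swap := fun h => hc' (by rw [h, Sum.swap_swap])
      simpa [hc'.symm, hc''] using hE a c c a
    have e1 := hd c hc hc'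
    have e2 := hd c.swap (fun h => hc' (by rw [← h, Sum.swap_swap]))
      (fun h => hc (by rw [← Sum.swap_swap c, h, Sum.swap_swap]))
    have e3 := h1 (Matrix.single c c 1)
    rw [sympInv_single, hss, one_smul] at e3
    refine (T.smul_mem_iff (two_ne_zero (α := F))).1 ?_
    convert add_mem (add_mem e1 e2) e3 using 1
    module
  · by_cases hb : b = a.swap
    · subst hb
      obtain ⟨c, hc, hc'⟩ := hex a
      have hc'' : a.swap ≠ c.swap := fun h => hc (by rw [← Sum.swap_swap c, ← h, Sum.swap_swap])
      -- The unit joining `a` to its swap needs a detour through a third index `c`.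
      simpa [hc'.symm, hc'', Sum.swap_ne_self] using hE a c c a.swap
    -- The idempotent `E_aa + E_a'a'`, with `a'` the swap of `a`, fixes `E_ab` from the left and
    -- kills it from the right.
    · simpa [Sum.swap_ne_self, Ne.symm hab, hb] using hE a a a b

theorem exists_isUnit_sympInv_eq_neg : ∃ u : MatEven F k₁, IsUnit u ∧ sympInv F k₁ u = -u := by
  refine ⟨Matrix.fromBlocks 1 0 0 (-1), ?_, ?_⟩
  · refine IsUnit.of_mul_eq_one (Matrix.fromBlocks 1 0 0 (-1)) ?_
    simp [Matrix.fromBlocks_multiply]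
  · simp [sympInv_fromBlocks, Matrix.fromBlocks_neg]

end Symplectic

/-! ### Weight spaces -/

namespace DoubleAff

variable {F : Type*} [Field F] {A : Type*} [Ring A] [Algebra F A] {σ : A →ₗ[F] A}

theorem elt_add_elt_eq_sym [CharZero F] (i : Fin 2) (u : A) (m n : ℕ) :
    elt u m n + symSign F i • elt (σ u) n m = sym σ i (((m ! * n ! : ℕ) : F)⁻¹ • u) m n := by
  rw [sym_smul, sym, elt_eq_mon F, elt_eq_mon F, mul_comm (n !)]
  module

theorem sym_eq_elt_add_elt (i : Fin 2) (u : A) (m n : ℕ) :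
    sym σ i u m n = ((m ! * n ! : ℕ) : F) • (elt u m n + symSign F i • elt (σ u) n m) := by
  rw [sym, mon, mon, mul_comm (n !)]
  module

theorem symSubspace_eq_span [CharZero F] (i : Fin 2) :
    symSubspace σ i = Submodule.span F {x | ∃ (u : A) (m n : ℕ),
      x = elt u m n + symSign F i • elt (σ u) n m} := by
  refine le_antisymm (Submodule.span_le.2 ?_) (Submodule.span_le.2 ?_)
  · rintro _ ⟨u, m, n, rfl⟩
    rw [sym_eq_elt_add_elt]
    exact Submodule.smul_mem _ _ (Submodule.subset_span ⟨u, m, n, rfl⟩)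
  · rintro _ ⟨u, m, n, rfl⟩
    rw [elt_add_elt_eq_sym]
    exact sym_mem σ i _ _ _

/-- The symmetrization operator `Θ` is multiplication by `2` on the symmetrized subspace and
preserves weight, so an element of the intersection is half the symmetrization of its monomials. -/
theorem symSubspace_inf_weightSpace [CharZero F] (hσ : IsLinearInvolution σ) (i : Fin 2) (w : ℕ) :
    symSubspace σ i ⊓ weightSpace F A i w =
      Submodule.span F {x | ∃ (u : A) (m n : ℕ), m + n + 1 + shift i = w ∧ x = sym σ i u m n} := by
  refine le_antisymm ?_ (Submodule.span_le.2 ?_)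
  · rintro x ⟨hx, hxw⟩
    set Θ : DoubleAff A →ₗ[F] DoubleAff A := LinearMap.id + symSign F i •
      Finsupp.lsum F (fun a : ℕ × ℕ => (Finsupp.lsingle (a.2, a.1)).comp σ) with hΘ
    have hΘe : ∀ u m n, Θ (elt u m n) = elt u m n + symSign F i • elt (σ u) n m := by
      intro u m n
      simp [hΘ, elt]
    have h1 : Θ x = (2 : F) • x := by
      clear hxw
      rw [SetLike.mem_coe, symSubspace_eq_span] at hx
      induction hx using Submodule.span_induction with
      | mem x hx =>
        obtain ⟨u, m, n, rfl⟩ := hx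
        rw [map_add, map_smul, hΘe, hΘe, hσ.map_map, smul_add, smul_smul, symSign_mul_self]
        module
      | zero => simp
      | add x y _ _ hx hy => rw [map_add, hx, hy, smul_add]
      | smul c x _ hx => rw [map_smul, hx, smul_comm]
    rw [← Submodule.smul_mem_iff _ (two_ne_zero (α := F)), ← h1]
    rw [weightSpace, SetLike.mem_coe] at hxw
    clear h1 hx
    induction hxw using Submodule.span_induction with
    | mem x hx =>
      obtain ⟨u, m, n, hw, rfl⟩ := hx
      rw [hΘe, elt_add_elt_eq_sym]
      exact Submodule.subset_span ⟨_, m, n, hw, rfl⟩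
    | zero => simp
    | add x y _ _ hx hy => rw [map_add]; exact add_mem hx hy
    | smul c x _ hx => rw [map_smul]; exact Submodule.smul_mem _ _ hx
  · rintro _ ⟨u, m, n, hw, rfl⟩
    refine ⟨sym_mem σ i u m n, ?_⟩
    rw [sym_eq_elt_add_elt]
    refine Submodule.smul_mem _ _ (add_mem (Submodule.subset_span ⟨u, m, n, hw, rfl⟩)
      (Submodule.smul_mem _ _ (Submodule.subset_span ⟨σ u, n, m, by omega, rfl⟩)))

end DoubleAff

/-! ### The two symplectic algebras: weight two and generation. -/

section Main

open DoubleAff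

variable (F : Type*) [Field F] (k₁ : ℕ)

theorem sym_single (i : Fin 2) (a b : Fin k₁ ⊕ Fin k₁) {m n : ℕ} (h : m + n ≤ 1) :
    sym (sympInvₗ F k₁) i (Matrix.single a b 1) m n = unitElt F a b m n +
      (symSign F i * (indexSign F a * indexSign F b)) • unitElt F b.swap a.swap n m := by
  have : m ! * n ! = 1 := by
    have : m = 0 ∧ n = 0 ∨ m = 0 ∧ n = 1 ∨ m = 1 ∧ n = 0 := by omega
    rcases this with ⟨rfl, rfl⟩ | ⟨rfl, rfl⟩ | ⟨rfl, rfl⟩ <;> rfl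
  rw [sym_eq_elt_add_elt, this, sympInvₗ_apply, sympInv_single]
  simp [unitElt, elt, mul_smul]

theorem span_sym_le {i : Fin 2} {d : ℕ} {T : Submodule F (DoubleAff (MatEven F k₁))}
    (h : ∀ a b m n, m + n = d → sym (sympInvₗ F k₁) i (Matrix.single a b 1) m n ∈ T) :
    Submodule.span F {x | ∃ u m n, m + n = d ∧ x = sym (sympInvₗ F k₁) i u m n} ≤ T := by
  refine Submodule.span_le.2 ?_
  rintro _ ⟨u, m, n, hmn, rfl⟩
  have : T.comap (symₗ (sympInvₗ F k₁) i m n) = ⊤ :=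
    Submodule.eq_top_of_single_mem fun a b => h a b m n hmn
  exact (this ▸ Submodule.mem_top : u ∈ T.comap (symₗ (sympInvₗ F k₁) i m n))

theorem matProd₂_one_elt (u v : MatEven F k₁) :
    matProd₂ F k₁ 1 (elt u 0 0) (elt v 0 0) = elt (u * v + v * u) 0 0 := by
  rw [matProd₂, prod_elt]
  simp [coeffLeft, coeffRight, shift, elt]

variable [CharZero F]

theorem RDagger₁_eq : RDagger₁ F k₁ = symSubspace (sympInvₗ F k₁) 1 := by
  rw [symSubspace_eq_span, RDagger₁]
  simp [symSign, shift, sub_eq_add_neg]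

theorem RDagger₂_eq : RDagger₂ F k₁ = symSubspace (sympInvₗ F k₁) 0 := by
  rw [symSubspace_eq_span, RDagger₂]
  simp [symSign, shift]

theorem RDagger₁.weight_two_eq : RDagger₁.weight F k₁ 2 = Submodule.span F
    {x | ∃ u m n, m + n = 1 ∧ x = sym (sympInvₗ F k₁) 1 u m n} := by
  rw [RDagger₁.weight, RDagger₁_eq, symSubspace_inf_weightSpace (isLinearInvolution_sympInvₗ F k₁)]
  simp [shift]

theorem RDagger₂.weight_two_eq : RDagger₂.weight F k₁ 2 = Submodule.span F
    {x | ∃ u m n, m + n = 0 ∧ x = sym (sympInvₗ F k₁) 0 u m n} := by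
  rw [RDagger₂.weight, RDagger₂_eq, symSubspace_inf_weightSpace (isLinearInvolution_sympInvₗ F k₁)]
  simp [shift]

theorem RDagger₁.weight_two_eq_span :
    RDagger₁.weight F k₁ 2 = Submodule.span F
      ({x | ∃ p q : Fin k₁,
          x = unitElt F (Sum.inl p) (Sum.inl q) 0 1 - unitElt F (Sum.inr q) (Sum.inr p) 1 0} ∪
       {x | ∃ p q : Fin k₁,
          x = unitElt F (Sum.inl p) (Sum.inl q) 1 0 - unitElt F (Sum.inr q) (Sum.inr p) 0 1} ∪
       {x | ∃ p q : Fin k₁,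
          x = unitElt F (Sum.inl p) (Sum.inr q) 1 0 + unitElt F (Sum.inl q) (Sum.inr p) 0 1} ∪
       {x | ∃ p q : Fin k₁,
          x = unitElt F (Sum.inr p) (Sum.inl q) 1 0 + unitElt F (Sum.inr q) (Sum.inl p) 0 1}) := by
  rw [RDagger₁.weight_two_eq]
  have hs : symSign F 1 = -1 := by simp [symSign, shift]
  refine le_antisymm (span_sym_le F k₁ ?_) (Submodule.span_le.2 ?_)
  · intro a b m n hmn
    rw [sym_single F k₁ 1 a b hmn.le, hs]
    obtain ⟨rfl, rfl⟩ | ⟨rfl, rfl⟩ : m = 0 ∧ n = 1 ∨ m = 1 ∧ n = 0 := by omega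
    · rcases a with p | p <;> rcases b with q | q
      · exact Submodule.subset_span (Or.inl (Or.inl (Or.inl
          ⟨p, q, by simp [indexSign, sub_eq_add_neg]⟩)))
      · exact Submodule.subset_span (Or.inl (Or.inr ⟨q, p, by simp [indexSign, add_comm]⟩))
      · exact Submodule.subset_span (Or.inr ⟨q, p, by simp [indexSign, add_comm]⟩)
      -- A unit in the lower right block symmetrizes to minus a generator from the upper left block.
      · refine (Submodule.neg_mem_iff _).1 (Submodule.subset_span (Or.inl (Or.inl (Or.inr
          ⟨q, p, by simp [indexSign, sub_eq_add_neg, add_comm]⟩))))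
    · rcases a with p | p <;> rcases b with q | q
      · exact Submodule.subset_span (Or.inl (Or.inl (Or.inr
          ⟨p, q, by simp [indexSign, sub_eq_add_neg]⟩)))
      · exact Submodule.subset_span (Or.inl (Or.inr ⟨p, q, by simp [indexSign]⟩))
      · exact Submodule.subset_span (Or.inr ⟨p, q, by simp [indexSign]⟩)
      · refine (Submodule.neg_mem_iff _).1 (Submodule.subset_span (Or.inl (Or.inl (Or.inl
          ⟨q, p, by simp [indexSign, sub_eq_add_neg, add_comm]⟩))))
  · have key : ∀ (a b : Fin k₁ ⊕ Fin k₁) (m n : ℕ), m + n = 1 → unitElt F a b m n +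
        (symSign F 1 * (indexSign F a * indexSign F b)) • unitElt F b.swap a.swap n m ∈
        Submodule.span F {x | ∃ u m n, m + n = 1 ∧ x = sym (sympInvₗ F k₁) 1 u m n} :=
      fun a b m n h => Submodule.subset_span ⟨_, m, n, h, (sym_single F k₁ 1 a b h.le).symm⟩
    rintro _ (((⟨p, q, rfl⟩ | ⟨p, q, rfl⟩) | ⟨p, q, rfl⟩) | ⟨p, q, rfl⟩)
    · simpa [indexSign, hs, sub_eq_add_neg] using key (Sum.inl p) (Sum.inl q) 0 1 rfl
    · simpa [indexSign, hs, sub_eq_add_neg] using key (Sum.inl p) (Sum.inl q) 1 0 rfl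
    · simpa [indexSign, hs] using key (Sum.inl p) (Sum.inr q) 1 0 rfl
    · simpa [indexSign, hs] using key (Sum.inr p) (Sum.inl q) 1 0 rfl

theorem RDagger₂.weight_two_eq_span :
    RDagger₂.weight F k₁ 2 = Submodule.span F
      ({x | ∃ p q : Fin k₁,
          x = unitElt F (Sum.inl p) (Sum.inl q) 0 0 + unitElt F (Sum.inr q) (Sum.inr p) 0 0} ∪
       {x | ∃ p q : Fin k₁,
          x = unitElt F (Sum.inl p) (Sum.inr q) 0 0 - unitElt F (Sum.inl q) (Sum.inr p) 0 0} ∪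
       {x | ∃ p q : Fin k₁,
          x = unitElt F (Sum.inr p) (Sum.inl q) 0 0 - unitElt F (Sum.inr q) (Sum.inl p) 0 0}) := by
  rw [RDagger₂.weight_two_eq]
  have hs : symSign F 0 = 1 := by simp [symSign, shift]
  refine le_antisymm (span_sym_le F k₁ ?_) (Submodule.span_le.2 ?_)
  · intro a b m n hmn
    obtain ⟨rfl, rfl⟩ : m = 0 ∧ n = 0 := by omega
    rw [sym_single F k₁ 0 a b zero_le_one, hs]
    rcases a with p | p <;> rcases b with q | q
    · exact Submodule.subset_span (Or.inl (Or.inl ⟨p, q, by simp [indexSign]⟩))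
    · exact Submodule.subset_span (Or.inl (Or.inr
        ⟨p, q, by simp [indexSign, sub_eq_add_neg]⟩))
    · exact Submodule.subset_span (Or.inr ⟨p, q, by simp [indexSign, sub_eq_add_neg]⟩)
    · exact Submodule.subset_span (Or.inl (Or.inl ⟨q, p, by simp [indexSign, add_comm]⟩))
  · have key : ∀ (a b : Fin k₁ ⊕ Fin k₁), unitElt F a b 0 0 +
        (symSign F 0 * (indexSign F a * indexSign F b)) • unitElt F b.swap a.swap 0 0 ∈
        Submodule.span F {x | ∃ u m n, m + n = 0 ∧ x = sym (sympInvₗ F k₁) 0 u m n} :=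
      fun a b => Submodule.subset_span ⟨_, 0, 0, rfl, (sym_single F k₁ 0 a b zero_le_one).symm⟩
    rintro _ ((⟨p, q, rfl⟩ | ⟨p, q, rfl⟩) | ⟨p, q, rfl⟩)
    · simpa [indexSign, hs] using key (Sum.inl p) (Sum.inl q)
    · simpa [indexSign, hs, sub_eq_add_neg] using key (Sum.inl p) (Sum.inr q)
    · simpa [indexSign, hs, sub_eq_add_neg] using key (Sum.inr p) (Sum.inl q)

theorem bijOn_elt_weight_two :
    Set.BijOn (fun u : MatEven F k₁ => elt u 0 0)
      {u | sympInv F k₁ u = u} (RDagger₂.weight F k₁ 2) := by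
  have hs : symSign F 0 = 1 := by simp [symSign, shift]
  have hsym : ∀ u, sym (sympInvₗ F k₁) 0 u 0 0 = elt (u + sympInv F k₁ u) 0 0 := by
    intro u
    simp [sym_eq_elt_add_elt, hs, elt]
  rw [RDagger₂.weight_two_eq]
  refine ⟨fun u hu => ?_, fun u _ v _ h => Finsupp.single_injective _ h, fun x hx => ?_⟩
  · refine Submodule.subset_span ⟨(2 : F)⁻¹ • u, 0, 0, rfl, ?_⟩
    rw [hsym, ← sympInvₗ_apply, map_smul, sympInvₗ_apply, show sympInv F k₁ u = u from hu,
      ← add_smul, ← two_mul, mul_inv_cancel₀ two_ne_zero, one_smul]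
  · rw [SetLike.mem_coe] at hx
    induction hx using Submodule.span_induction with
    | mem x hx =>
      obtain ⟨u, m, n, hmn, rfl⟩ := hx
      obtain ⟨rfl, rfl⟩ : m = 0 ∧ n = 0 := by omega
      refine ⟨_, ?_, (hsym u).symm⟩
      have := (isLinearInvolution_sympInvₗ F k₁).map_map u
      simp only [sympInvₗ_apply] at this
      rw [Set.mem_ofPred_eq, ← sympInvₗ_apply, map_add, sympInvₗ_apply, sympInvₗ_apply, this,
        add_comm]
    | zero => exact ⟨0, map_zero (sympInvₗ F k₁), by simp [elt]⟩
    | add x y _ _ hx hy =>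
      obtain ⟨u, hu, rfl⟩ := hx
      obtain ⟨v, hv, rfl⟩ := hy
      refine ⟨u + v, ?_, by simp [elt]⟩
      rw [Set.mem_ofPred_eq] at *
      rw [← sympInvₗ_apply, map_add, sympInvₗ_apply, sympInvₗ_apply, hu, hv]
    | smul c x _ hx =>
      obtain ⟨u, hu, rfl⟩ := hx
      refine ⟨c • u, ?_, by simp [elt]⟩
      rw [Set.mem_ofPred_eq] at *
      rw [← sympInvₗ_apply, map_smul, sympInvₗ_apply, hu]

/-! ### Generation of the two algebras -/

variable {F k₁} in
theorem isConformallyGeneratedBy_of_symLevel {i : Fin 2} {S : Set (DoubleAff (MatEven F k₁))}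
    (hS : S ⊆ symSubspace (sympInvₗ F k₁) i) {q : MatEven F k₁} (hq : q + sympInv F k₁ q = 1)
    (hqS : sym (sympInvₗ F k₁) i q (1 - shift i) 0 ∈ wordSpan F i S)
    (h : (∀ x ∈ wordSpan F i S, deriv F (MatEven F k₁) x ∈ wordSpan F i S) →
      symLevel (sympInvₗ F k₁) i (wordSpan F i S) 0 = ⊤ ∧
      symLevel (sympInvₗ F k₁) i (wordSpan F i S) 1 = ⊤ ∧
      symLevel (sympInvₗ F k₁) i (wordSpan F i S) (2 - shift i) = ⊤) :
    IsConformallyGeneratedBy F (prod F (MatEven F k₁) i) (symSubspace (sympInvₗ F k₁) i) S := by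
  have hσ := isLinearInvolution_sympInvₗ F k₁
  have hle : wordSpan F i S ≤ symSubspace (sympInvₗ F k₁) i :=
    wordSpan_le hS fun n u hu v hv => prod_mem_symSubspace hσ i n hu hv
  have hD : ∀ x ∈ wordSpan F i S, deriv F (MatEven F k₁) x ∈ wordSpan F i S := by
    intro x hx
    rw [← prod_zero_sym hσ hq (hle hx)]
    exact prod_mem_wordSpan 0 hqS hx
  obtain ⟨h0, h1, h2⟩ := h hD
  obtain ⟨u, hu, hu'⟩ := exists_isUnit_sympInv_eq_neg (F := F) (k₁ := k₁)
  exact le_antisymm (symSubspace_le_of_symLevel hD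
    (fun n x hx y hy => prod_mem_wordSpan n hx hy) hσ hu hu' h0 h1 h2) hle

-- Weight two is exactly total degree `1 - δ`, so that level is full. Degree `2 - δ` follows from
-- symmetric matrices and commutators; the only other low degree is `0` when `δ = 0`.
variable {F k₁} in
theorem isConformallyGeneratedBy_weight_two_aux (hk : 1 < k₁) {i : Fin 2}
    {S : Submodule F (DoubleAff (MatEven F k₁))}
    (hS : S = Submodule.span F
      {x | ∃ u m n, m + n = 1 - shift i ∧ x = sym (sympInvₗ F k₁) i u m n}) :
    IsConformallyGeneratedBy F (prod F (MatEven F k₁) i) (symSubspace (sympInvₗ F k₁) i) S := by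
  have hσ := isLinearInvolution_sympInvₗ F k₁
  have hmem : symLevel (sympInvₗ F k₁) i (wordSpan F i (S : Set _)) (1 - shift i) = ⊤ := by
    refine Submodule.eq_top_iff'.2 fun t a b hab => subset_wordSpan ?_
    rw [hS]
    exact Submodule.subset_span ⟨t, a, b, hab, rfl⟩
  have hY : ∀ n, ∀ x ∈ wordSpan F i (S : Set _), ∀ y ∈ wordSpan F i (S : Set _),
    prod F (MatEven F k₁) i n x y ∈ wordSpan F i (S : Set _) :=
      fun n x hx y hy => prod_mem_wordSpan n hx hy
  refine isConformallyGeneratedBy_of_symLevel (q := (2 : F)⁻¹ • 1) ?_ ?_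
    (sym_mem_of_symLevel_eq_top hmem _ (add_zero _)) fun hD => ?_
  · rw [hS]
    refine Submodule.span_le.2 ?_
    rintro _ ⟨u, m, n, -, rfl⟩
    exact sym_mem _ i u m n
  · have h1 := hσ.map_one
    rw [← sympInvₗ_apply, map_smul, h1, ← add_smul, ← two_mul, mul_inv_cancel₀ two_ne_zero,
      one_smul]
  · have h2 : symLevel (sympInvₗ F k₁) i (wordSpan F i (S : Set _)) (2 - shift i) = ⊤ :=
      Submodule.eq_top_of_sympInv_symm_mem hk (add_map_mem_symLevel hD hσ hmem)
        (commutator_mem_symLevel hD hY hσ hmem)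
    have hi : i = 0 ∨ i = 1 := by fin_cases i <;> simp
    rcases hi with rfl | rfl
    · exact ⟨hmem, h2, h2⟩
    · refine ⟨Submodule.eq_top_iff'.2 fun t a b hab => ?_, hmem, h2⟩
      obtain ⟨rfl, rfl⟩ : a = 0 ∧ b = 0 := by omega
      -- The second product of `x` and `t x` lowers the degree to zero and yields the symmetrization
      -- of `2 t`.
      have h3 := hY 2 _ (sym_mem_of_symLevel_eq_top hmem 1 (add_zero _)) _
        (sym_mem_of_symLevel_eq_top hmem t (add_zero _))
      rw [prod_sym hσ] at h3
      have h1 := hσ.map_one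
      rw [sympInvₗ_apply] at h1
      simp [symCoeff, symSign, shift, h1, Nat.descFactorial] at h3
      rw [sym_smul] at h3
      exact (Submodule.smul_mem_iff _ two_ne_zero).1 h3

theorem isConformallyGeneratedBy_RDagger₁_weight_two (hk : 1 < k₁) :
    IsConformallyGeneratedBy F (matProd₁ F k₁) (RDagger₁ F k₁) (RDagger₁.weight F k₁ 2) := by
  rw [RDagger₁_eq]
  exact isConformallyGeneratedBy_weight_two_aux hk (RDagger₁.weight_two_eq F k₁)

theorem isConformallyGeneratedBy_RDagger₂_weight_two (hk : 1 < k₁) :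
    IsConformallyGeneratedBy F (matProd₂ F k₁) (RDagger₂ F k₁) (RDagger₂.weight F k₁ 2) := by
  rw [RDagger₂_eq]
  exact isConformallyGeneratedBy_weight_two_aux hk (RDagger₂.weight_two_eq F k₁)

end Main

/-! ### Generation for two-by-two matrices. -/

section RankOne

open DoubleAff

variable (F : Type*) [Field F]

variable {F} in
theorem Submodule.eq_top_of_single_mem_one {T : Submodule F (MatEven F 1)}
    (he : Matrix.single (Sum.inl 0) (Sum.inr 0) 1 ∈ T)
    (hf : Matrix.single (Sum.inr 0) (Sum.inl 0) 1 ∈ T)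
    (hp : Matrix.single (Sum.inl 0) (Sum.inl 0) 1 ∈ T)
    (hq : Matrix.single (Sum.inr 0) (Sum.inr 0) 1 ∈ T) : T = ⊤ := by
  refine Submodule.eq_top_of_single_mem fun a b => ?_
  rcases a with a | a <;> rcases b with b | b <;> obtain rfl := Subsingleton.elim a 0 <;>
    obtain rfl := Subsingleton.elim b 0 <;> assumption

theorem single_add_single_eq_one : (Matrix.single (Sum.inl 0) (Sum.inl 0) 1 +
    Matrix.single (Sum.inr 0) (Sum.inr 0) 1 : MatEven F 1) = 1 := by
  ext a b
  rcases a with a | a <;> rcases b with b | b <;> obtain rfl := Subsingleton.elim a 0 <;>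
    obtain rfl := Subsingleton.elim b 0 <;> simp

variable [CharZero F]

theorem isConformallyGeneratedBy_RDagger₂_one :
    IsConformallyGeneratedBy F (matProd₂ F 1) (RDagger₂ F 1)
      {elt 1 0 0,
       unitElt F (Sum.inl 0) (Sum.inr 0) 1 0 - unitElt F (Sum.inl 0) (Sum.inr 0) 0 1,
       unitElt F (Sum.inr 0) (Sum.inl 0) 1 0 - unitElt F (Sum.inr 0) (Sum.inl 0) 0 1} := by
  rw [RDagger₂_eq]
  set e : MatEven F 1 := Matrix.single (Sum.inl 0) (Sum.inr 0) 1 with he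
  set f : MatEven F 1 := Matrix.single (Sum.inr 0) (Sum.inl 0) 1 with hf
  set p : MatEven F 1 := Matrix.single (Sum.inl 0) (Sum.inl 0) 1 with hp
  set q : MatEven F 1 := Matrix.single (Sum.inr 0) (Sum.inr 0) 1 with hq
  set S : Set (DoubleAff (MatEven F 1)) := {elt 1 0 0,
       unitElt F (Sum.inl 0) (Sum.inr 0) 1 0 - unitElt F (Sum.inl 0) (Sum.inr 0) 0 1,
       unitElt F (Sum.inr 0) (Sum.inl 0) 1 0 - unitElt F (Sum.inr 0) (Sum.inl 0) 0 1} with hS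
  have hσ := isLinearInvolution_sympInvₗ F 1
  have hσe : sympInv F 1 e = -e := by simp [he, sympInv_single, indexSign]
  have hσf : sympInv F 1 f = -f := by simp [hf, sympInv_single, indexSign]
  have hσp : sympInv F 1 p = q := by simp [hp, hq, sympInv_single, indexSign]
  have hσq : sympInv F 1 q = p := by simp [hp, hq, sympInv_single, indexSign]
  have hpq : p + q = 1 := single_add_single_eq_one F
  have hef : e * f = p := by simp [he, hf, hp]
  have h1S : sym (sympInvₗ F 1) 0 p 0 0 = elt 1 0 0 := by
    rw [← hpq]
    simp [sym_eq_elt_add_elt, symSign, shift, hσp, elt]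
  have heS : sym (sympInvₗ F 1) 0 e 1 0 =
      unitElt F (Sum.inl 0) (Sum.inr 0) 1 0 - unitElt F (Sum.inl 0) (Sum.inr 0) 0 1 := by
    rw [sym_single F 1 0 _ _ le_rfl]
    simp [symSign, shift, indexSign, sub_eq_add_neg]
  have hfS : sym (sympInvₗ F 1) 0 f 1 0 =
      unitElt F (Sum.inr 0) (Sum.inl 0) 1 0 - unitElt F (Sum.inr 0) (Sum.inl 0) 0 1 := by
    rw [sym_single F 1 0 _ _ le_rfl]
    simp [symSign, shift, indexSign, sub_eq_add_neg]
  have m1 : sym (sympInvₗ F 1) 0 p 0 0 ∈ wordSpan F 0 S :=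
    subset_wordSpan (by rw [h1S, hS]; simp)
  have me : sym (sympInvₗ F 1) 0 e 1 0 ∈ wordSpan F 0 S :=
    subset_wordSpan (by rw [heS, hS]; simp)
  have mf : sym (sympInvₗ F 1) 0 f 1 0 ∈ wordSpan F 0 S :=
    subset_wordSpan (by rw [hfS, hS]; simp)
  refine isConformallyGeneratedBy_of_symLevel (q := p) ?_ (by rw [hσp, hpq]) m1 fun hD => ?_
  · rintro x hx
    rw [hS, ← h1S, ← heS, ← hfS] at hx
    rcases hx with rfl | rfl | rfl <;> exact sym_mem _ _ _ _ _
  have h0 : symLevel (sympInvₗ F 1) 0 (wordSpan F 0 S) 0 = ⊤ := by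
    have hz : ∀ t, sym (sympInvₗ F 1) 0 t 0 0 ∈ wordSpan F 0 S →
        t ∈ symLevel (sympInvₗ F 1) 0 (wordSpan F 0 S) 0 := by
      intro t ht a b hab
      obtain ⟨rfl, rfl⟩ : a = 0 ∧ b = 0 := by omega
      exact ht
    -- In degree zero `e` and `f` are free: they are skew for `σ`, so their symmetrizations vanish.
    refine Submodule.eq_top_of_single_mem_one (hz e ?_) (hz f ?_) (hz p m1) (hz q ?_)
    · simp [sym, symSign, shift, hσe, mon_neg]
    · simp [sym, symSign, shift, hσf, mon_neg]
    · rw [sym_swap hσ, sympInvₗ_apply, hσq]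
      exact Submodule.smul_mem _ _ m1
  have h1 : symLevel (sympInvₗ F 1) 0 (wordSpan F 0 S) 1 = ⊤ := by
    have hone : p + q ∈ symLevel (sympInvₗ F 1) 0 (wordSpan F 0 S) 1 := by
      have := add_map_mem_symLevel hD hσ h0 p
      rwa [sympInvₗ_apply, hσp] at this
    -- The second product of `e x` and `f x` folds to `(8 p - 2 q) x`; adding twice `p + q` isolates
    -- `10 p`.
    have h2 := prod_mem_wordSpan 2 me mf
    rw [prod_sym hσ] at h2
    simp [symCoeff, symSign, shift, hσe, hσf, Nat.descFactorial, add_mul, hef] at h2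
    have h3 : sym (sympInvₗ F 1) 0 ((2 : F) • p + (6 : F) • p) 1 0 +
        sym (sympInvₗ F 1) 0 (-((2 : F) • p)) 0 1 =
        sym (sympInvₗ F 1) 0 ((8 : F) • p + (-2 : F) • q) 1 0 := by
      rw [← add_smul, ← neg_smul, show (2 : F) + 6 = 8 by norm_num,
        sym_add, sym_smul, sym_smul, sym_smul, sym_swap hσ 0 p 0 1, sympInvₗ_apply, hσp]
      simp [symSign, shift]
    have h4 := mem_symLevel_succ hD h0 (add_zero 1) (h3 ▸ h2)
    have hp1 : p ∈ symLevel (sympInvₗ F 1) 0 (wordSpan F 0 S) 1 := by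
      refine (Submodule.smul_mem_iff _ (show (10 : F) ≠ 0 by norm_num)).1 ?_
      convert add_mem h4 (Submodule.smul_mem _ (2 : F) hone) using 1
      module
    have hq1 : q ∈ symLevel (sympInvₗ F 1) 0 (wordSpan F 0 S) 1 :=
      (Submodule.add_mem_iff_right _ hp1).1 hone
    exact Submodule.eq_top_of_single_mem_one
      (mem_symLevel_succ hD h0 (add_zero 1) me) (mem_symLevel_succ hD h0 (add_zero 1) mf) hp1 hq1
  exact ⟨h0, h1, h1⟩

theorem isConformallyGeneratedBy_RDagger₁_one :
    IsConformallyGeneratedBy F (matProd₁ F 1) (RDagger₁ F 1)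
      {unitElt F (Sum.inl 0) (Sum.inr 0) 2 0 + unitElt F (Sum.inl 0) (Sum.inr 0) 0 2,
       unitElt F (Sum.inr 0) (Sum.inl 0) 2 0 + unitElt F (Sum.inr 0) (Sum.inl 0) 0 2,
       unitElt F (Sum.inl 0) (Sum.inl 0) 0 1 - unitElt F (Sum.inr 0) (Sum.inr 0) 1 0} := by
  rw [RDagger₁_eq]
  set e : MatEven F 1 := Matrix.single (Sum.inl 0) (Sum.inr 0) 1 with he
  set f : MatEven F 1 := Matrix.single (Sum.inr 0) (Sum.inl 0) 1 with hf
  set p : MatEven F 1 := Matrix.single (Sum.inl 0) (Sum.inl 0) 1 with hp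
  set q : MatEven F 1 := Matrix.single (Sum.inr 0) (Sum.inr 0) 1 with hq
  set S : Set (DoubleAff (MatEven F 1)) :=
    {unitElt F (Sum.inl 0) (Sum.inr 0) 2 0 + unitElt F (Sum.inl 0) (Sum.inr 0) 0 2,
     unitElt F (Sum.inr 0) (Sum.inl 0) 2 0 + unitElt F (Sum.inr 0) (Sum.inl 0) 0 2,
     unitElt F (Sum.inl 0) (Sum.inl 0) 0 1 - unitElt F (Sum.inr 0) (Sum.inr 0) 1 0} with hS
  have hσ := isLinearInvolution_sympInvₗ F 1
  have hσe : sympInv F 1 e = -e := by simp [he, sympInv_single, indexSign]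
  have hσf : sympInv F 1 f = -f := by simp [hf, sympInv_single, indexSign]
  have hσp : sympInv F 1 p = q := by simp [hp, hq, sympInv_single, indexSign]
  have hσq : sympInv F 1 q = p := by simp [hp, hq, sympInv_single, indexSign]
  have hpq : p + q = 1 := single_add_single_eq_one F
  have hef : e * f = p := by simp [he, hf, hp]
  have hqe : q * e = 0 := by simp [he, hq]
  have hpe : p * e = e := by simp [he, hp]
  have hpf : p * f = 0 := by simp [hf, hp]
  have hqf : q * f = f := by simp [hf, hq]
  have heS : sym (sympInvₗ F 1) 1 ((2 : F)⁻¹ • e) 2 0 =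
      unitElt F (Sum.inl 0) (Sum.inr 0) 2 0 + unitElt F (Sum.inl 0) (Sum.inr 0) 0 2 := by
    rw [sym_smul, sym_eq_elt_add_elt, sympInvₗ_apply, hσe]
    simp [symSign, shift, unitElt, elt, he]
  have hfS : sym (sympInvₗ F 1) 1 ((2 : F)⁻¹ • f) 2 0 =
      unitElt F (Sum.inr 0) (Sum.inl 0) 2 0 + unitElt F (Sum.inr 0) (Sum.inl 0) 0 2 := by
    rw [sym_smul, sym_eq_elt_add_elt, sympInvₗ_apply, hσf]
    simp [symSign, shift, unitElt, elt, hf]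
  have hpS : sym (sympInvₗ F 1) 1 p 0 1 =
      unitElt F (Sum.inl 0) (Sum.inl 0) 0 1 - unitElt F (Sum.inr 0) (Sum.inr 0) 1 0 := by
    rw [sym_single F 1 1 _ _ le_rfl]
    simp [symSign, shift, indexSign, sub_eq_add_neg]
  have hswap : ∀ (t : MatEven F 1) (a b : ℕ), sym (sympInvₗ F 1) 1 t a b =
      -sym (sympInvₗ F 1) 1 (sympInv F 1 t) b a := by
    intro t a b
    rw [sym_swap hσ]
    simp [symSign, shift]
  have hsc : ∀ {c : F} {t : MatEven F 1} {a b : ℕ}, c ≠ 0 →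
      sym (sympInvₗ F 1) 1 (c • t) a b ∈ wordSpan F 1 S →
        sym (sympInvₗ F 1) 1 t a b ∈ wordSpan F 1 S := by
    intro c t a b hc h
    rw [sym_smul] at h
    exact (Submodule.smul_mem_iff _ hc).1 h
  -- The `2⁻¹` undoes the factor `2!` in the divided power basis.
  have e2 : sym (sympInvₗ F 1) 1 e 2 0 ∈ wordSpan F 1 S :=
    hsc (c := 2⁻¹) (by simp) (subset_wordSpan (by rw [heS, hS]; simp))
  have f2 : sym (sympInvₗ F 1) 1 f 2 0 ∈ wordSpan F 1 S :=
    hsc (c := 2⁻¹) (by simp) (subset_wordSpan (by rw [hfS, hS]; simp))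
  have q1 : sym (sympInvₗ F 1) 1 q 1 0 ∈ wordSpan F 1 S := by
    rw [hswap, hσq, Submodule.neg_mem_iff]
    exact subset_wordSpan (by rw [hpS, hS]; simp)
  refine isConformallyGeneratedBy_of_symLevel (q := q) ?_ (by rw [hσq, add_comm, hpq]) q1
    fun hD => ?_
  · rintro x hx
    rw [hS, ← heS, ← hfS, ← hpS] at hx
    rcases hx with rfl | rfl | rfl <;> exact sym_mem _ _ _ _ _
  -- The second and third products with `q x` lower `e x²` to `e x` and `e`. Products of `e` with `f
  -- x²` then supply the diagonal coefficients in degrees `1`, `2` and `0`.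
  have e1 : sym (sympInvₗ F 1) 1 e 1 0 ∈ wordSpan F 1 S := by
    have h := prod_mem_wordSpan 2 q1 e2
    rw [prod_sym hσ] at h
    simp [symCoeff, symSign, shift, hσe, hσq, Nat.descFactorial, add_mul, hqe, hpe] at h
    exact hsc (by norm_num) h
  have e0 : sym (sympInvₗ F 1) 1 e 0 0 ∈ wordSpan F 1 S := by
    have h := prod_mem_wordSpan 3 q1 e2
    rw [prod_sym hσ] at h
    simp [symCoeff, symSign, shift, hσe, hσq, Nat.descFactorial, hpe] at h
    exact hsc (by norm_num) h
  have f1 : sym (sympInvₗ F 1) 1 f 1 0 ∈ wordSpan F 1 S := by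
    have h := prod_mem_wordSpan 2 q1 f2
    rw [prod_sym hσ] at h
    simp [symCoeff, symSign, shift, hσf, hσq, Nat.descFactorial, add_mul, hpf, hqf] at h
    exact hsc (by norm_num) h
  have p1 : sym (sympInvₗ F 1) 1 p 1 0 ∈ wordSpan F 1 S := by
    have h := prod_mem_wordSpan 1 e0 f2
    rw [prod_sym hσ] at h
    simp [symCoeff, symSign, shift, hσe, hσf, Nat.descFactorial, add_mul, hef] at h
    refine hsc (c := 4) (by norm_num) ?_
    rwa [show (4 : F) • p = (2 : F) • p + (2 : F) • p by module]
  have pq2 : sym (sympInvₗ F 1) 1 (p - q) 2 0 ∈ wordSpan F 1 S := by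
    have h := prod_mem_wordSpan 0 e0 f2
    rw [prod_sym hσ] at h
    simp [symCoeff, symSign, shift, hσe, hσf, Nat.descFactorial, add_mul, hef] at h
    have h' : sym (sympInvₗ F 1) 1 (p + p) 2 0 + -sym (sympInvₗ F 1) 1 (-p + -p) 0 2 =
        sym (sympInvₗ F 1) 1 ((2 : F) • (p - q)) 2 0 := by
      rw [show -p + -p = (-2 : F) • p by module, show p + p = (2 : F) • p by module,
        show (2 : F) • (p - q) = (2 : F) • p + (-2 : F) • q by module, sym_add, sym_smul, sym_smul,
        sym_smul, hswap p 0 2, hσp]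
      module
    exact hsc two_ne_zero (h' ▸ h)
  have p0 : sym (sympInvₗ F 1) 1 p 0 0 ∈ wordSpan F 1 S := by
    have h := prod_mem_wordSpan 2 e0 f2
    rw [prod_sym hσ] at h
    simp [symCoeff, symSign, shift, hσe, hσf, Nat.descFactorial, add_mul, hef] at h
    refine hsc (c := 4) (by norm_num) ?_
    rwa [show (4 : F) • p = (2 : F) • p + (2 : F) • p by module]
  have f0 : sym (sympInvₗ F 1) 1 f 0 0 ∈ wordSpan F 1 S := by
    -- Here `p x` is needed, not `q x`: the third product multiplies `f` by the `σ`-image of the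
    -- coefficient, and `σ p = q` fixes `f` while `σ q = p` kills it.
    have h := prod_mem_wordSpan 3 p1 f2
    rw [prod_sym hσ] at h
    simp [symCoeff, symSign, shift, hσf, hσp, Nat.descFactorial, hqf] at h
    exact hsc (by norm_num) h
  have h0 : symLevel (sympInvₗ F 1) 1 (wordSpan F 1 S) 0 = ⊤ := by
    have hz : ∀ t, sym (sympInvₗ F 1) 1 t 0 0 ∈ wordSpan F 1 S →
        t ∈ symLevel (sympInvₗ F 1) 1 (wordSpan F 1 S) 0 := by
      intro t ht a b hab
      obtain ⟨rfl, rfl⟩ : a = 0 ∧ b = 0 := by omega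
      exact ht
    refine Submodule.eq_top_of_single_mem_one (hz e e0) (hz f f0) (hz p p0) (hz q ?_)
    rw [hswap, hσq]
    exact Submodule.neg_mem _ p0
  have h1 : symLevel (sympInvₗ F 1) 1 (wordSpan F 1 S) 1 = ⊤ :=
    have hz := fun (t : MatEven F 1) => mem_symLevel_succ (t := t) hD h0 (add_zero 1)
    Submodule.eq_top_of_single_mem_one (hz e e1) (hz f f1) (hz p p1) (hz q q1)
  refine ⟨h0, h1, ?_⟩
  have hz := fun (t : MatEven F 1) => mem_symLevel_succ (t := t) hD h1 (add_zero 2)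
  have hone : p + q ∈ symLevel (sympInvₗ F 1) 1 (wordSpan F 1 S) 2 := by
    have := add_map_mem_symLevel hD hσ h1 p
    rwa [sympInvₗ_apply, hσp] at this
  have hsub := hz _ pq2
  have hp2 : p ∈ symLevel (sympInvₗ F 1) 1 (wordSpan F 1 S) 2 := by
    refine (Submodule.smul_mem_iff _ (two_ne_zero (α := F))).1 ?_
    convert add_mem hone hsub using 1
    module
  exact Submodule.eq_top_of_single_mem_one (hz e e2) (hz f f2) hp2
    ((Submodule.add_mem_iff_right _ hp2).1 hone)

end RankOne

theorem theorem3p3 (F : Type*) [Field F] [CharZero F] :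
    -- both algebras are simple conformal algebras, for every `k = 2k₁`
    (∀ k₁ : ℕ, 1 ≤ k₁ →
      IsSimpleConformalAlgebra F (matDeriv F k₁) (matProd₁ F k₁) (RDagger₁ F k₁) ∧
      IsSimpleConformalAlgebra F (matDeriv F k₁) (matProd₂ F k₁) (RDagger₂ F k₁)) ∧
    -- their subspaces of weight two
    (∀ k₁ : ℕ, 1 ≤ k₁ →
      RDagger₁.weight F k₁ 2 = Submodule.span F
        ({x | ∃ p q : Fin k₁,
            x = unitElt F (Sum.inl p) (Sum.inl q) 0 1 - unitElt F (Sum.inr q) (Sum.inr p) 1 0} ∪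
         {x | ∃ p q : Fin k₁,
            x = unitElt F (Sum.inl p) (Sum.inl q) 1 0 - unitElt F (Sum.inr q) (Sum.inr p) 0 1} ∪
         {x | ∃ p q : Fin k₁,
            x = unitElt F (Sum.inl p) (Sum.inr q) 1 0 + unitElt F (Sum.inl q) (Sum.inr p) 0 1} ∪
         {x | ∃ p q : Fin k₁,
            x = unitElt F (Sum.inr p) (Sum.inl q) 1 0 + unitElt F (Sum.inr q) (Sum.inl p) 0 1}) ∧
      RDagger₂.weight F k₁ 2 = Submodule.span F
        ({x | ∃ p q : Fin k₁,
            x = unitElt F (Sum.inl p) (Sum.inl q) 0 0 + unitElt F (Sum.inr q) (Sum.inr p) 0 0} ∪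
         {x | ∃ p q : Fin k₁,
            x = unitElt F (Sum.inl p) (Sum.inr q) 0 0 - unitElt F (Sum.inl q) (Sum.inr p) 0 0} ∪
         {x | ∃ p q : Fin k₁,
            x = unitElt F (Sum.inr p) (Sum.inl q) 0 0 - unitElt F (Sum.inr q) (Sum.inl p) 0 0})) ∧
    -- generation for `k₁ > 1`
    (∀ k₁ : ℕ, 1 < k₁ →
      IsConformallyGeneratedBy F (matProd₁ F k₁) (RDagger₁ F k₁) (RDagger₁.weight F k₁ 2) ∧
      IsConformallyGeneratedBy F (matProd₂ F k₁) (RDagger₂ F k₁) (RDagger₂.weight F k₁ 2)) ∧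
    -- generation for `k₁ = 1`
    IsConformallyGeneratedBy F (matProd₁ F 1) (RDagger₁ F 1)
      {unitElt F (Sum.inl 0) (Sum.inr 0) 2 0 + unitElt F (Sum.inl 0) (Sum.inr 0) 0 2,
       unitElt F (Sum.inr 0) (Sum.inl 0) 2 0 + unitElt F (Sum.inr 0) (Sum.inl 0) 0 2,
       unitElt F (Sum.inl 0) (Sum.inl 0) 0 1 - unitElt F (Sum.inr 0) (Sum.inr 0) 1 0} ∧
    IsConformallyGeneratedBy F (matProd₂ F 1) (RDagger₂ F 1)
      {DoubleAff.elt 1 0 0,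
       unitElt F (Sum.inl 0) (Sum.inr 0) 1 0 - unitElt F (Sum.inl 0) (Sum.inr 0) 0 1,
       unitElt F (Sum.inr 0) (Sum.inl 0) 1 0 - unitElt F (Sum.inr 0) (Sum.inl 0) 0 1} ∧
    -- `u ↦ u(0, 0)` identifies the symplectic-symmetric matrices under `uv + vu` with the
    -- subspace of weight two of the second algebra under the weight-preserving product
    (∀ k₁ : ℕ, 1 ≤ k₁ →
      Set.BijOn (fun u : MatEven F k₁ => DoubleAff.elt u 0 0)
        {u | sympInv F k₁ u = u} (RDagger₂.weight F k₁ 2) ∧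
      ∀ u v : MatEven F k₁, sympInv F k₁ u = u → sympInv F k₁ v = v →
        matProd₂ F k₁ 1 (DoubleAff.elt u 0 0) (DoubleAff.elt v 0 0) =
          DoubleAff.elt (u * v + v * u) 0 0) := by
  refine ⟨fun k₁ hk => ?_, fun k₁ _ => ⟨RDagger₁.weight_two_eq_span F k₁,
    RDagger₂.weight_two_eq_span F k₁⟩, fun k₁ hk =>
    ⟨isConformallyGeneratedBy_RDagger₁_weight_two F k₁ hk,
      isConformallyGeneratedBy_RDagger₂_weight_two F k₁ hk⟩,
    isConformallyGeneratedBy_RDagger₁_one F, isConformallyGeneratedBy_RDagger₂_one F,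
    fun k₁ _ => ⟨bijOn_elt_weight_two F k₁, fun u v _ _ => matProd₂_one_elt F k₁ u v⟩⟩
  -- Needed for the matrix algebra to be a simple ring.
  have : Nonempty (Fin k₁) := ⟨⟨0, hk⟩⟩
  rw [RDagger₁_eq, RDagger₂_eq]
  exact ⟨DoubleAff.isSimpleConformalAlgebra_symSubspace (isLinearInvolution_sympInvₗ F k₁) 1,
    DoubleAff.isSimpleConformalAlgebra_symSubspace (isLinearInvolution_sympInvₗ F k₁) 0⟩
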